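/- Let $A$ be an artin algebra, i.e. an algebra that is finitely generated as a module over a commutative artinian ring. "Module" means left module, not necessarily finitely generated; right $A$-modules are left $A^{\mathrm{op}}$-modules. The algebra $A$ is Gorenstein if the regular modules ${}_AA$ and $A_A$ both have finite injective dimension; in that case $\mathrm{G.dim}\,A$ denotes the common value of $\mathrm{inj.dim}\,{}_AA$ and $\mathrm{inj.dim}\,A_A$. An acyclic complex $P^\bullet$ of projective $A$-modules is totally acyclic if $\mathrm{Hom}_A(P^\bullet,Q)$ is acyclic for every projective $A$-module $Q$. An $A$-module is Gorenstein-projective if it is isomorphic to the zeroth cocycle $Z^0(P^\bullet)$ of a totally acyclic complex $P^\bullet$. A proper Gorenstein-projective resolution of an $A$-module $M$ is an exact complex $\cdots\to G^{-1}\to G^0\to M\to 0$ with all $G^{-i}$ Gorenstein-projective that stays exact under $\mathrm{Hom}_A(G,-)$ for every Gorenstein-projective $G$; every module over an artin algebra has one, and it is unique up to homotopy equivalence. For an $A$-module $N$ let $\mathrm{Ext}^n_{\mathrm{GP}}(M,N)=H^n(\mathrm{Hom}_A(G^\bullet,N))$, and put $\mathrm{GP.dim}\,M=\sup\{n\ge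 0\mid \mathrm{Ext}^n_{\mathrm{GP}}(M,-)\ne 0\}$ and $\mathrm{gl.GP.dim}\,A=\sup_M \mathrm{GP.dim}\,M$, the supremum over all $A$-modules $M$. (All dimensions of a zero module are $\sup\emptyset=-\infty$, which counts as finite.) Then $A$ is Gorenstein if and only if $\mathrm{gl.GP.dim}\,A<\infty$. In this case $\mathrm{G.dim}\,A=\mathrm{gl.GP.dim}\,A$, that is, $\mathrm{inj.dim}\,{}_AA=\mathrm{inj.dim}\,A_A=\mathrm{gl.GP.dim}\,A$. -/

import Mathlib

open CategoryTheory

universe u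

/-- A totally acyclic complex of (arbitrary) `A`-modules: an acyclic complex `P` of projective
modules such that `Hom_A(P, Q)` is acyclic for every projective module `Q`.
Complexes indexed by `ℤ` are written homologically, with `P.X n` in cohomological degree `-n`. -/
structure IsTotallyAcyclic {A : Type u} [Ring A] (P : ChainComplex (ModuleCat.{u} A) ℤ) :
    Prop where
  projective (n : ℤ) : Projective (P.X n)
  acyclic : P.Acyclic
  acyclic_hom (Q : ModuleCat.{u} A) (hQ : Projective Q) : (P.linearYonedaObj ℤ Q).Acyclic

/-- A (not necessarily finitely generated) `A`-module is Gorenstein-projective if it is the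
kernel `Z_0(P) = ker (P_0 → P_{-1})` of the zeroth differential of a totally acyclic complex. -/
def IsGorensteinProjective {A : Type u} [Ring A] (M : ModuleCat.{u} A) : Prop :=
  ∃ P : ChainComplex (ModuleCat.{u} A) ℤ, IsTotallyAcyclic P ∧ Nonempty (P.cycles 0 ≅ M)

/-- A complex `X` of `A`-modules is right GP-acyclic if `Hom_A(G, X)` is acyclic for every
Gorenstein-projective module `G`. -/
def IsRightGPAcyclic {A : Type u} [Ring A] {ι : Type*} {c : ComplexShape ι}
    (X : HomologicalComplex (ModuleCat.{u} A) c) : Prop :=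
  ∀ G : ModuleCat.{u} A, IsGorensteinProjective G →
    (((preadditiveCoyoneda.obj (Opposite.op G)).mapHomologicalComplex c).obj X).Acyclic

/-- A proper Gorenstein-projective resolution `⋯ → G_2 → G_1 → G_0 → M → 0` of `M`. -/
structure ProperGPResolution {A : Type u} [Ring A] (M : ModuleCat.{u} A) where
  complex : ChainComplex (ModuleCat.{u} A) ℕ
  ε : complex.X 0 ⟶ M
  d_comp_ε : complex.d 1 0 ≫ ε = 0
  gorensteinProjective (n : ℕ) : IsGorensteinProjective (complex.X n)
  acyclic : (complex.augment ε d_comp_ε).Acyclic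
  proper : IsRightGPAcyclic (complex.augment ε d_comp_ε)

/-- The GP-extension group `Ext_GP^n(M, N) = H^n(Hom_A(G, N))`, computed by a proper
GP-resolution `G` of `M`. -/
noncomputable def ProperGPResolution.ext {A : Type u} [Ring A] {M : ModuleCat.{u} A}
    (G : ProperGPResolution M) (n : ℕ) (N : ModuleCat.{u} A) : ModuleCat.{u} ℤ :=
  (G.complex.linearYonedaObj ℤ N).homology n

theorem isZero_homology_linearYonedaObj_iff {A : Type u} [Ring A]
    (K : ChainComplex (ModuleCat.{u} A) ℕ) (N : ModuleCat.{u} A) (n : ℕ) :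
    Limits.IsZero ((K.linearYonedaObj ℤ N).homology n) ↔
      ∀ f : K.X n ⟶ N, K.d (n + 1) n ≫ f = 0 →
        ∃ g : K.X ((ComplexShape.down ℕ).next n) ⟶ N, K.d n _ ≫ g = f := by
  rw [← HomologicalComplex.exactAt_iff_isZero_homology,
    HomologicalComplex.exactAt_iff' _ ((ComplexShape.down ℕ).next n) n (n + 1) rfl (by simp),
    ShortComplex.moduleCat_exact_iff]
  rfl

namespace ProperGPResolution

variable {A : Type u} [Ring A] {M : ModuleCat.{u} A}

theorem exists_lift_zero (G : ProperGPResolution M) {X : ModuleCat.{u} A}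
    (hX : IsGorensteinProjective X) (f : X ⟶ M) :
    ∃ g : X ⟶ G.complex.X 0, g ≫ G.ε = f := by
  have h := G.proper X hX 0
  rw [HomologicalComplex.exactAt_iff' _ 1 0 0 (by simp) (by simp), ShortComplex.ab_exact_iff] at h
  exact h f (show f ≫ (0 : M ⟶ M) = 0 from Limits.comp_zero)

theorem exists_lift_one (G : ProperGPResolution M) {X : ModuleCat.{u} A}
    (hX : IsGorensteinProjective X) (f : X ⟶ G.complex.X 0) (hf : f ≫ G.ε = 0) :
    ∃ g : X ⟶ G.complex.X 1, g ≫ G.complex.d 1 0 = f := by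
  have h := G.proper X hX 1
  rw [HomologicalComplex.exactAt_iff' _ 2 1 0 (by simp) (by simp), ShortComplex.ab_exact_iff] at h
  exact h f hf

theorem exists_lift_succ (G : ProperGPResolution M) {X : ModuleCat.{u} A}
    (hX : IsGorensteinProjective X) (n : ℕ) (f : X ⟶ G.complex.X (n + 1))
    (hf : f ≫ G.complex.d (n + 1) n = 0) :
    ∃ g : X ⟶ G.complex.X (n + 2), g ≫ G.complex.d (n + 2) (n + 1) = f := by
  have h := G.proper X hX (n + 2)
  rw [HomologicalComplex.exactAt_iff' _ (n + 3) (n + 2) (n + 1) (by simp) (by simp),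
    ShortComplex.ab_exact_iff] at h
  exact h f hf

/-- Comparison theorem, existence. -/
theorem exists_lift (G G' : ProperGPResolution M) :
    ∃ φ : G.complex ⟶ G'.complex, φ.f 0 ≫ G'.ε = G.ε := by
  obtain ⟨g₀, h₀⟩ := G'.exists_lift_zero (G.gorensteinProjective 0) G.ε
  obtain ⟨g₁, h₁⟩ := G'.exists_lift_one (G.gorensteinProjective 1) (G.complex.d 1 0 ≫ g₀)
    (by rw [Category.assoc, h₀, G.d_comp_ε])
  refine ⟨ChainComplex.mkHom _ _ g₀ g₁ h₁ fun n p ↦ ?_, by simpa using h₀⟩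
  have := G'.exists_lift_succ (G.gorensteinProjective (n + 2)) n
    (G.complex.d (n + 2) (n + 1) ≫ p.2.1) (by simp [p.2.2])
  exact ⟨this.choose, this.choose_spec⟩

/-- Comparison theorem, uniqueness up to homotopy. -/
theorem nonempty_homotopy_zero (G G' : ProperGPResolution M) (φ : G.complex ⟶ G'.complex)
    (hφ : φ.f 0 ≫ G'.ε = 0) : Nonempty (Homotopy φ 0) := by
  obtain ⟨h₀, e₀⟩ := G'.exists_lift_one (G.gorensteinProjective 0) (φ.f 0) hφ
  obtain ⟨h₁, e₁⟩ := G'.exists_lift_succ (G.gorensteinProjective 1) 0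
    (φ.f 1 - G.complex.d 1 0 ≫ h₀) (by simp [e₀])
  refine ⟨Homotopy.mkInductive _ h₀ e₀.symm h₁ (by simp [e₁]) fun n p ↦ ?_⟩
  have := G'.exists_lift_succ (G.gorensteinProjective (n + 2)) (n + 1)
    (φ.f (n + 2) - G.complex.d (n + 2) (n + 1) ≫ p.2.1) (by simp [p.2.2])
  exact ⟨this.choose, by simp [this.choose_spec]⟩

/-- The vanishing of a GP-extension group does not depend on the proper GP-resolution. -/
theorem isZero_ext_iff (G G' : ProperGPResolution M) (n : ℕ) (N : ModuleCat.{u} A) :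
    Limits.IsZero (G.ext n N) ↔ Limits.IsZero (G'.ext n N) := by
  suffices H : ∀ G G' : ProperGPResolution M,
      Limits.IsZero (G'.ext n N) → Limits.IsZero (G.ext n N) from ⟨H G' G, H G G'⟩
  intro G G' h
  rw [ext, isZero_homology_linearYonedaObj_iff] at h ⊢
  intro f hf
  obtain ⟨φ, hφ⟩ := exists_lift G G'
  obtain ⟨ψ, hψ⟩ := exists_lift G' G
  obtain ⟨s⟩ := nonempty_homotopy_zero G G (φ ≫ ψ - 𝟙 _) (by simp [hφ, hψ])
  obtain ⟨g, hg⟩ := h (ψ.f n ≫ f) (by rw [← ψ.comm_assoc, hf, Limits.comp_zero])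
  have hs := s.comm n
  rw [prevD_eq s.hom (show (ComplexShape.down ℕ).Rel (n + 1) n from rfl)] at hs
  replace hs := congrArg (· ≫ f) hs
  simp [hf, dNext, sub_eq_iff_eq_add, ← hg] at hs
  refine ⟨φ.f _ ≫ g - s.hom _ n ≫ f, ?_⟩
  simp [hs]

end ProperGPResolution

/-- The Gorenstein-projective dimension `GP.dim M = sup {n ≥ 0 | Ext_GP^n(M, -) ≠ 0}`, where
`Ext_GP` is computed by a proper GP-resolution of `M`. The supremum is the same for all proper
GP-resolutions of `M` (see `gpDim_eq`), so the outer infimum only says "take a proper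
GP-resolution". As for other dimensions in Mathlib, the zero module has dimension `⊥ = sup ∅`;
a module without any proper GP-resolution would count as being of infinite dimension (over an
artin algebra there is no such module). -/
noncomputable def gpDim {A : Type u} [Ring A] (M : ModuleCat.{u} A) : WithBot ℕ∞ :=
  ⨅ G : ProperGPResolution M,
    ⨆ (n : ℕ) (_ : ∃ N : ModuleCat.{u} A, ¬ Limits.IsZero (G.ext n N)), (n : WithBot ℕ∞)

/-- The Gorenstein-projective dimension can be computed with any proper GP-resolution. -/
theorem gpDim_eq {A : Type u} [Ring A] {M : ModuleCat.{u} A} (G : ProperGPResolution M) :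
    gpDim M = ⨆ (n : ℕ) (_ : ∃ N : ModuleCat.{u} A, ¬ Limits.IsZero (G.ext n N)), (n : WithBot ℕ∞) := by
  have : Nonempty (ProperGPResolution M) := ⟨G⟩
  unfold gpDim
  have key : ∀ G' : ProperGPResolution M,
    (⨆ (n : ℕ) (_ : ∃ N : ModuleCat.{u} A, ¬ Limits.IsZero (G'.ext n N)), (n : WithBot ℕ∞)) = ⨆ (n : ℕ) (_ : ∃ N : ModuleCat.{u} A, ¬ Limits.IsZero (G.ext n N)), (n : WithBot ℕ∞) := fun G' ↦ by
    simp only [G'.isZero_ext_iff G]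
  simp only [key, ciInf_const]

/-- The global Gorenstein-projective dimension: the supremum of `GP.dim M` over all modules. -/
noncomputable def globalGPDim (A : Type u) [Ring A] : WithBot ℕ∞ :=
  ⨆ M : ModuleCat.{u} A, gpDim M

/-- `A` is Gorenstein if the regular module has finite injective dimension on both sides.
Right `A`-modules are left modules over `Aᵐᵒᵖ`. -/
def IsGorensteinAlgebra (A : Type u) [Ring A] : Prop :=
  injectiveDimension (ModuleCat.of A A) < ⊤ ∧ injectiveDimension (ModuleCat.of Aᵐᵒᵖ A) < ⊤

/-!
Suppose `A` has finite injective dimension on both sides. A direct sum of copies of `A` is pure in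
the product, so every projective module `Q` has injective dimension at most `n = inj.dim A`, that
is, `Ext^i(M, Q) = 0` for all `M` and all `i > n`. Character duality exchanges left and right
modules, projectives and injectives, and turns the finiteness on the other side into finite
projective dimension of the injective left modules (Iwanaga). Embedding modules into injectives
`n` times and shifting back, every `M` becomes a quotient of some `G` with `Ext^i(G, Q) = 0` for
all `i > 0` and projective `Q`, by a kernel of finite projective dimension. Such a `G` is
Gorenstein-projective and such an epimorphism is a Gorenstein-projective precover, since
`Ext^1(G', Y) = 0` for `G'` Gorenstein-projective and `Y` of finite projective dimension. Iterating
gives a proper resolution whose short exact sequences split from the `n`-th on.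

Conversely, if all proper resolutions split after `n` steps, every `M` has an `n`-step resolution by
Gorenstein-projectives, because these are closed under direct summands. Dimension shifting gives
`Ext^i(M, Q) = 0` for `i > n` and `Q` projective, hence `inj.dim Q ≤ n`. Pushouts along the
resolution embed `M` into a module of finite projective dimension, so injective modules are direct
summands of such modules and have projective dimension at most `n`; their character modules then
bound `inj.dim` of `A` as a right module. The three dimensions agree because each of them is at
most `n` as soon as one of the others is.
-/

/-! ### Vanishing of `Ext` and dimension shifting -/

section Ext

open Abelian

universe w v' u'

variable {C : Type u'} [Category.{v'} C] [Abelian C]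

section ShortExact

variable [HasExt.{w} C] {S : ShortComplex C} (hS : S.ShortExact) (n : ℕ)

include hS

theorem subsingleton_ext_X₁ (Y : C) (h₂ : Subsingleton (Ext S.X₂ Y n))
    (h₃ : Subsingleton (Ext S.X₃ Y (n + 1))) : Subsingleton (Ext S.X₁ Y n) := by
  refine subsingleton_of_forall_eq 0 fun x ↦ ?_
  obtain ⟨y, rfl⟩ := Ext.contravariant_sequence_exact₁ hS Y x (add_comm 1 n) (Subsingleton.elim _ _)
  rw [Subsingleton.elim y 0, Ext.comp_zero]

theorem subsingleton_ext_X₂ (Y : C) (h₁ : Subsingleton (Ext S.X₁ Y n))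
    (h₃ : Subsingleton (Ext S.X₃ Y n)) : Subsingleton (Ext S.X₂ Y n) := by
  refine subsingleton_of_forall_eq 0 fun x ↦ ?_
  obtain ⟨y, rfl⟩ := Ext.contravariant_sequence_exact₂ hS Y x (Subsingleton.elim _ _)
  rw [Subsingleton.elim y 0, Ext.comp_zero]

theorem subsingleton_ext_X₃ (Y : C) (h₁ : Subsingleton (Ext S.X₁ Y n))
    (h₂ : Subsingleton (Ext S.X₂ Y (n + 1))) : Subsingleton (Ext S.X₃ Y (n + 1)) := by
  refine subsingleton_of_forall_eq 0 fun x ↦ ?_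
  obtain ⟨y, rfl⟩ := Ext.contravariant_sequence_exact₃ hS Y x (Subsingleton.elim _ _) (add_comm 1 n)
  rw [Subsingleton.elim y 0, Ext.comp_zero]

theorem subsingleton_ext_to_X₃ (X : C) (h₁ : Subsingleton (Ext X S.X₁ (n + 1)))
    (h₂ : Subsingleton (Ext X S.X₂ n)) : Subsingleton (Ext X S.X₃ n) := by
  refine subsingleton_of_forall_eq 0 fun x ↦ ?_
  obtain ⟨y, rfl⟩ := Ext.covariant_sequence_exact₃ X hS x rfl (Subsingleton.elim _ _)
  rw [Subsingleton.elim y 0, Ext.zero_comp]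

theorem exists_extension_of_subsingleton_ext_one {Y : C} (h : Subsingleton (Ext S.X₃ Y 1))
    (f : S.X₁ ⟶ Y) : ∃ g : S.X₂ ⟶ Y, S.f ≫ g = f := by
  obtain ⟨y, hy⟩ := Ext.contravariant_sequence_exact₁ hS Y (Ext.mk₀ f) (add_zero 1)
    (Subsingleton.elim _ _)
  obtain ⟨g, rfl⟩ := Ext.homEquiv₀.symm.surjective y
  exact ⟨g, Ext.homEquiv₀.symm.injective (by simpa using hy)⟩

theorem exists_lift_of_subsingleton_ext_one {X : C} (h : Subsingleton (Ext X S.X₁ 1))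
    (f : X ⟶ S.X₃) : ∃ g : X ⟶ S.X₂, g ≫ S.g = f := by
  obtain ⟨y, hy⟩ := Ext.covariant_sequence_exact₃ X hS (Ext.mk₀ f) (zero_add 1)
    (Subsingleton.elim _ _)
  obtain ⟨g, rfl⟩ := Ext.homEquiv₀.symm.surjective y
  exact ⟨g, Ext.homEquiv₀.symm.injective (by simpa using hy)⟩

theorem subsingleton_ext_one_of_exists_extension {Y : C} (h₂ : Subsingleton (Ext S.X₂ Y 1))
    (h : ∀ f : S.X₁ ⟶ Y, ∃ g : S.X₂ ⟶ Y, S.f ≫ g = f) : Subsingleton (Ext S.X₃ Y 1) := by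
  refine subsingleton_of_forall_eq 0 fun x ↦ ?_
  obtain ⟨y, rfl⟩ := Ext.contravariant_sequence_exact₃ hS Y x (Subsingleton.elim _ _) (add_zero 1)
  obtain ⟨f, rfl⟩ := Ext.homEquiv₀.symm.surjective y
  obtain ⟨g, rfl⟩ := h f
  simpa using hS.extClass_comp_assoc (Ext.mk₀ g) (h := add_zero 1)

end ShortExact

theorem subsingleton_ext_of_retract [HasExt.{w} C] {X X' : C} (r : Retract X X') (Y : C) (n : ℕ)
    (h : Subsingleton (Ext X' Y n)) : Subsingleton (Ext X Y n) := by
  refine subsingleton_of_forall_eq 0 fun x ↦ ?_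
  have hx : (Ext.mk₀ r.i).comp ((Ext.mk₀ r.r).comp x (zero_add n)) (zero_add n) = x := by
    rw [Ext.mk₀_comp_mk₀_assoc, r.retract, Ext.mk₀_id_comp]
  rw [← hx, Subsingleton.elim ((Ext.mk₀ r.r).comp x (zero_add n)) 0, Ext.comp_zero]

/-- `K` is a syzygy of `M`: the kernel of some epimorphism from a projective object to `M`. -/
def IsSyzygy (K M : C) : Prop :=
  ∃ (P : C) (i : K ⟶ P) (p : P ⟶ M) (w : i ≫ p = 0),
    Projective P ∧ (ShortComplex.mk i p w).ShortExact

theorem exists_isSyzygy [EnoughProjectives C] (M : C) : ∃ K : C, IsSyzygy K M := by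
  let ⟨p⟩ := EnoughProjectives.presentation M
  exact ⟨_, _, _, p.f, Limits.kernel.condition p.f, p.projective,
    { exact := ShortComplex.exact_kernel p.f }⟩

theorem shortExact_iso_comp {K K' E N : C} (e : K ≅ K') {i : K ⟶ E} {p : E ⟶ N} {w : i ≫ p = 0}
    (hS : (ShortComplex.mk i p w).ShortExact) :
    (ShortComplex.mk (e.inv ≫ i) p (by rw [Category.assoc, w, Limits.comp_zero])).ShortExact :=
  ShortComplex.shortExact_of_iso
    (ShortComplex.isoMk (S₁ := .mk i p w) e (Iso.refl _) (Iso.refl _) (by simp) (by simp)) hS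

theorem IsSyzygy.of_iso {K K' M : C} (h : IsSyzygy K M) (e : K ≅ K') : IsSyzygy K' M := by
  obtain ⟨P, i, p, w, hP, hS⟩ := h
  exact ⟨P, e.inv ≫ i, p, _, hP, shortExact_iso_comp e hS⟩

theorem exists_shortExact_injective [EnoughInjectives C] (M : C) :
    ∃ (I K : C) (i : M ⟶ I) (p : I ⟶ K) (w : i ≫ p = 0),
      Injective I ∧ (ShortComplex.mk i p w).ShortExact := by
  let ⟨p⟩ := EnoughInjectives.presentation M
  exact ⟨_, _, p.f, _, Limits.cokernel.condition p.f, p.injective,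
    { exact := ShortComplex.exact_cokernel p.f }⟩

theorem hasProjectiveDimensionLT_of_isSyzygy_closed [HasExt.{w} C] [EnoughProjectives C]
    {P : C → Prop} (hP : ∀ K M, IsSyzygy K M → P M → P K) (n : ℕ) {M : C} (hM : P M)
    (h : ∀ L, P L → Subsingleton (Ext M L (n + 1))) : HasProjectiveDimensionLT M (n + 1) := by
  induction n generalizing M with
  | zero =>
    obtain ⟨K, hKM⟩ := exists_isSyzygy M
    have hK := hP K M hKM hM
    obtain ⟨Q, i, p, w, hQ, hS⟩ := hKM
    obtain ⟨s, hs⟩ := exists_lift_of_subsingleton_ext_one hS (h K hK) (𝟙 M)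
    exact (Retract.mk s p hs).hasProjectiveDimensionLT 1
  | succ n ih =>
    obtain ⟨K, hKM⟩ := exists_isSyzygy M
    have hK := hP K M hKM hM
    obtain ⟨Q, i, p, w, hQ, hS⟩ := hKM
    refine (hS.hasProjectiveDimensionLT_X₃_iff n hQ).2 (ih hK fun L hL ↦ ?_)
    exact subsingleton_ext_X₁ hS (n + 1) L (Ext.subsingleton_of_projective _ _ _) (h L hL)

theorem hasInjectiveDimensionLT_of_subsingleton_ext_injective [HasExt.{w} C] [EnoughInjectives C]
    {M : C} (n k : ℕ) (hM : HasInjectiveDimensionLT M (n + k))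
    (h : ∀ J : C, Injective J → ∀ i ≥ n, Subsingleton (Ext J M i)) :
    HasInjectiveDimensionLT M n := by
  induction k with
  | zero => exact hM
  | succ k ih =>
    refine ih (HasInjectiveDimensionLT.mk fun i hi X x ↦ ?_)
    obtain ⟨J, L, j, p, w, hJ, hS⟩ := exists_shortExact_injective X
    have := subsingleton_ext_X₁ hS i M (h J hJ i (by lia))
      (HasInjectiveDimensionLT.subsingleton M (n + (k + 1)) (i + 1) (by lia) L)
    exact Subsingleton.elim x 0

theorem hasInjectiveDimensionLT_of_exact_of_injective {D : Type*} [Category* D] [Abelian D]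
    [EnoughInjectives C] (F : C → D) (hF : ∀ J : C, Injective J → Injective (F J))
    (hexact : ∀ S : ShortComplex C, S.ShortExact →
      ∃ (f : F S.X₁ ⟶ F S.X₂) (g : F S.X₂ ⟶ F S.X₃) (w : f ≫ g = 0),
        (ShortComplex.mk f g w).ShortExact)
    (n : ℕ) {M : C} (hM : HasInjectiveDimensionLT M (n + 1)) :
    HasInjectiveDimensionLT (F M) (n + 1) := by
  induction n generalizing M with
  | zero =>
    have := hF M (injective_iff_hasInjectiveDimensionLT_one.2 hM)
    infer_instance
  | succ n ih =>
    obtain ⟨J, K, i, p, w, hJ, hS⟩ := exists_shortExact_injective M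
    obtain ⟨f, g, w', hS'⟩ := hexact _ hS
    exact (hS'.hasInjectiveDimensionLT_X₃_iff n (hF J hJ)).1
      (ih ((hS.hasInjectiveDimensionLT_X₃_iff n hJ).2 hM))

end Ext

/-! ### Purity and character modules -/

section Purity

variable {A : Type u} [Ring A] {M N L : Type u} [AddCommGroup M] [Module A M]
  [AddCommGroup N] [Module A N] [AddCommGroup L] [Module A L]

/-- The additive map `M ^ q → M ^ r` given by an `r × q` matrix over `A`, so that finite linear
systems over `A` with unknowns and right-hand side in `M` read `matrixHom T M x = y`. -/
def matrixHom {r q : ℕ} (T : Matrix (Fin r) (Fin q) A) (M : Type u) [AddCommGroup M] [Module A M] :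
    (Fin q → M) →+ (Fin r → M) :=
  AddMonoidHom.mk' (fun x i ↦ ∑ j, T i j • x j) fun x y ↦ by
    ext i
    simp [Finset.sum_add_distrib]

theorem matrixHom_apply {r q : ℕ} (T : Matrix (Fin r) (Fin q) A) (x : Fin q → M) (i : Fin r) :
    matrixHom T M x i = ∑ j, T i j • x j := rfl

/-- A linear map `u : M → N` is pure if every finite linear system with right-hand side in `M`
which has a solution in `N` has a solution in `M`. Systems without unknowns force `u` to be
injective, so this is the usual purity of the submodule `M` of `N`. -/
def IsPureMap (u : M →ₗ[A] N) : Prop :=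
  ∀ ⦃r q : ℕ⦄ (T : Matrix (Fin r) (Fin q) A) (y : Fin r → M) (z : Fin q → N),
    matrixHom T N z = u ∘ y → ∃ x, matrixHom T M x = y

theorem IsPureMap.exists_extension {u : M →ₗ[A] N} (hu : IsPureMap u) {K : Type u}
    [AddCommGroup K] [Module A K] [Module.Finite A K] {q : ℕ} (i : K →ₗ[A] (Fin q → A))
    (f : K →ₗ[A] M) (g : (Fin q → A) →ₗ[A] N) (hg : g ∘ₗ i = u ∘ₗ f) :
    ∃ h : (Fin q → A) →ₗ[A] M, h ∘ₗ i = f := by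
  obtain ⟨r, k, hk⟩ := Module.Finite.exists_fin (R := A) (M := K)
  obtain ⟨x, hx⟩ := hu (.of fun j ↦ i (k j)) (fun j ↦ f (k j)) (fun l ↦ g (Pi.single l 1)) <| by
    funext j
    refine Eq.trans ?_ (LinearMap.congr_fun hg (k j))
    conv_rhs => rw [LinearMap.comp_apply, pi_eq_sum_univ' (i (k j)), map_sum]
    simp [matrixHom_apply]
  refine ⟨Fintype.linearCombination A x, LinearMap.ext_on_range hk fun j ↦ ?_⟩
  exact congrFun hx j

theorem isPureMap_finsupp (ι M : Type u) [AddCommGroup M] [Module A M] :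
    IsPureMap (Finsupp.lcoeFun : (ι →₀ M) →ₗ[A] ι → M) := by
  classical
  intro r q T y z hz
  let s : Finset ι := Finset.univ.biUnion fun i ↦ (y i).support
  let x (j : Fin q) : ι →₀ M := Finsupp.onFinset s (fun a ↦ if a ∈ s then z j a else 0)
    (by simp +contextual)
  refine ⟨x, funext fun i ↦ Finsupp.ext fun a ↦ ?_⟩
  have hza : ∑ j, T i j • z j a = y i a := by
    simpa [matrixHom_apply] using congrFun (congrFun hz i) a
  by_cases ha : a ∈ s
  · simp [matrixHom_apply, x, ha, hza]
  · have hy : y i a = 0 := by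
      by_contra h
      exact ha (Finset.mem_biUnion.2 ⟨i, Finset.mem_univ i, Finsupp.mem_support_iff.2 h⟩)
    simp [matrixHom_apply, x, ha, hy]

end Purity

/-- The ring isomorphism `B ≃ Aᵐᵒᵖ` obtained from `A ≃ Bᵐᵒᵖ` by passing to opposite rings. -/
def swapOp {A B : Type u} [Ring A] [Ring B] (τ : A ≃+* Bᵐᵒᵖ) : B ≃+* Aᵐᵒᵖ :=
  (RingEquiv.opOp B).trans (RingEquiv.op τ.symm)

/-- The character module `Hom_ℤ(M, ℚ/ℤ)` of a left `A`-module `M`. It is naturally a right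
`A`-module, which is encoded as a left module over a ring `B` with a chosen isomorphism
`τ : A ≃ Bᵐᵒᵖ`; the character module of a `B`-module is then an `A`-module via `swapOp τ`. -/
def CharDual {A B : Type u} [Ring A] [Ring B] (_τ : A ≃+* Bᵐᵒᵖ) (M : Type u) [AddCommGroup M] :
    Type u :=
  M →+ AddCircle (1 : ℚ)

namespace CharDual

variable {A B : Type u} [Ring A] [Ring B] {τ : A ≃+* Bᵐᵒᵖ} {M N L : Type u} [AddCommGroup M]
  [AddCommGroup N] [AddCommGroup L]

instance : AddCommGroup (CharDual τ M) := inferInstanceAs (AddCommGroup (M →+ AddCircle (1 : ℚ)))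

instance : FunLike (CharDual τ M) M (AddCircle (1 : ℚ)) :=
  inferInstanceAs (FunLike (M →+ AddCircle (1 : ℚ)) M (AddCircle (1 : ℚ)))

instance : AddMonoidHomClass (CharDual τ M) M (AddCircle (1 : ℚ)) :=
  inferInstanceAs (AddMonoidHomClass (M →+ AddCircle (1 : ℚ)) M (AddCircle (1 : ℚ)))

@[ext] theorem ext {f g : CharDual τ M} (h : ∀ x, f x = g x) : f = g := DFunLike.ext _ _ h

@[simp] theorem add_apply (f g : CharDual τ M) (x : M) : (f + g) x = f x + g x := rfl

@[simp] theorem zero_apply (x : M) : (0 : CharDual τ M) x = 0 := rfl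

theorem sum_apply {ι : Type*} (s : Finset ι) (f : ι → CharDual τ M) (x : M) :
    (∑ i ∈ s, f i) x = ∑ i ∈ s, f i x :=
  AddMonoidHom.finsetSum_apply f s x

variable (τ) in
/-- A homomorphism to `ℚ/ℤ` as an element of the character module, which is a type synonym so that
it can carry the action of `B` without disturbing the instances on `M →+ ℚ/ℤ`. -/
def of (f : M →+ AddCircle (1 : ℚ)) : CharDual τ M := f

@[simp] theorem of_apply (f : M →+ AddCircle (1 : ℚ)) (x : M) : of τ f x = f x := rfl

theorem exists_character_eq_zero_ne_zero (H : AddSubgroup M) {x : M} (hx : x ∉ H) :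
    ∃ χ : M →+ AddCircle (1 : ℚ), (∀ y ∈ H, χ y = 0) ∧ χ x ≠ 0 := by
  obtain ⟨χ, hχ⟩ := CharacterModule.exists_character_apply_ne_zero_of_ne_zero
    ((QuotientAddGroup.eq_zero_iff x).not.2 hx)
  refine ⟨AddMonoidHom.comp χ (QuotientAddGroup.mk' H), fun y hy ↦ ?_, hχ⟩
  change χ (QuotientAddGroup.mk y) = 0
  rw [(QuotientAddGroup.eq_zero_iff y).2 hy, map_zero]

theorem exists_character_extension {f : M →+ N} (hf : Function.Injective f)
    (χ : M →+ AddCircle (1 : ℚ)) : ∃ ψ : N →+ AddCircle (1 : ℚ), ψ.comp f = χ := by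
  obtain ⟨ψ, hψ⟩ := CharacterModule.dual_surjective_of_injective f.toIntLinearMap hf χ
  exact ⟨ψ, hψ⟩

theorem exists_character_factorization (g : N →+ L) (χ : N →+ AddCircle (1 : ℚ))
    (hχ : g.ker ≤ χ.ker) : ∃ ψ : L →+ AddCircle (1 : ℚ), ψ.comp g = χ := by
  obtain ⟨ψ, hψ⟩ := exists_character_extension (QuotientAddGroup.kerLift_injective g)
    (QuotientAddGroup.lift g.ker χ hχ)
  exact ⟨ψ, AddMonoidHom.ext fun y ↦ DFunLike.congr_fun hψ (QuotientAddGroup.mk y)⟩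

section Functoriality

variable [Module A M] [Module A N] [Module A L]

instance : Module B (CharDual τ M) where
  smul b f := of τ (AddMonoidHom.comp f (DistribSMul.toAddMonoidHom M (τ.symm (.op b))))
  one_smul f := by ext x; change f (τ.symm (.op 1) • x) = _; simp
  mul_smul b c f := by
    ext x
    change f (τ.symm (.op (b * c)) • x) = f (τ.symm (.op c) • τ.symm (.op b) • x)
    simp [mul_smul]
  smul_zero b := rfl
  zero_smul f := by ext x; change f (τ.symm (.op 0) • x) = _; simp
  smul_add b f g := rfl
  add_smul b c f := by
    ext x
    change f (τ.symm (.op (b + c)) • x) = f (τ.symm (.op b) • x) + f (τ.symm (.op c) • x)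
    simp [add_smul]

theorem smul_apply (b : B) (f : CharDual τ M) (x : M) :
    (b • f) x = f (τ.symm (.op b) • x) := rfl

@[simp] theorem unop_smul_apply (a : A) (f : CharDual τ M) (x : M) :
    ((τ a).unop • f) x = f (a • x) := by
  simp [smul_apply]

@[simp] theorem swapOp_smul_apply {X : Type u} [AddCommGroup X] [Module B X] (a : A)
    (f : CharDual (swapOp τ) X) (x : X) : (a • f) x = f ((τ a).unop • x) := rfl

variable (τ) in
/-- The action on linear maps of the contravariant functor of character modules. -/
def map (f : M →ₗ[A] N) : CharDual τ N →ₗ[B] CharDual τ M where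
  toFun χ := of τ (AddMonoidHom.comp χ f.toAddMonoidHom)
  map_add' _ _ := rfl
  map_smul' b χ := by
    ext x
    exact congrArg χ (f.map_smul (τ.symm (.op b)) x).symm

@[simp] theorem map_apply (f : M →ₗ[A] N) (χ : CharDual τ N) (x : M) : map τ f χ x = χ (f x) := rfl

theorem map_surjective {f : M →ₗ[A] N} (hf : Function.Injective f) :
    Function.Surjective (map τ f) :=
  fun χ ↦ exists_character_extension (f := f.toAddMonoidHom) hf χ

theorem map_injective {f : M →ₗ[A] N} (hf : Function.Surjective f) :
    Function.Injective (map τ f) := fun χ ψ h ↦ ext fun y ↦ by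
  obtain ⟨x, rfl⟩ := hf y
  exact DFunLike.congr_fun h x

theorem map_exact {f : M →ₗ[A] N} {g : N →ₗ[A] L} (h : Function.Exact f g) :
    Function.Exact (map τ g) (map τ f) := fun χ ↦ by
  refine ⟨fun hχ ↦ exists_character_factorization g.toAddMonoidHom χ fun y hy ↦ ?_, ?_⟩
  · obtain ⟨x, rfl⟩ := (h y).1 hy
    exact DFunLike.congr_fun hχ x
  · rintro ⟨ψ, rfl⟩
    ext x
    simp [h.apply_apply_eq_zero]

/-- The adjunction `Hom_B(X, M^*) ≃ Hom_A(M, X^*)`: both sides are the biadditive pairings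
`X × M → ℚ/ℤ` which are balanced over `A`. -/
def transpose {X : Type u} [AddCommGroup X] [Module B X] :
    (X →ₗ[B] CharDual τ M) ≃ (M →ₗ[A] CharDual (swapOp τ) X) where
  toFun f :=
    { toFun := fun m ↦ of _ (AddMonoidHom.mk' (fun x ↦ f x m) (by simp))
      map_add' := fun m n ↦ by ext x; exact map_add (f x) m n
      map_smul' := fun a m ↦ by ext x; simp }
  invFun g :=
    { toFun := fun x ↦ of _ (AddMonoidHom.mk' (fun m ↦ g m x) (by simp))
      map_add' := fun x y ↦ by ext m; exact map_add (g m) x y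
      map_smul' := fun b x ↦ by
        ext m
        obtain ⟨a, rfl⟩ : ∃ a, (τ a).unop = b := ⟨τ.symm (.op b), by simp⟩
        simp }

variable (τ M) in
/-- The canonical evaluation map of a module into its double dual, a pure monomorphism. -/
def eval : M →ₗ[A] CharDual (swapOp τ) (CharDual τ M) := transpose LinearMap.id

theorem transpose_injective_of_surjective {X : Type u} [AddCommGroup X] [Module B X]
    {f : X →ₗ[B] CharDual τ M} (hf : Function.Surjective f) : Function.Injective (transpose f) := by
  rw [injective_iff_map_eq_zero]
  intro m hm
  by_contra hm'
  obtain ⟨χ, hχ⟩ := CharacterModule.exists_character_apply_ne_zero_of_ne_zero hm'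
  obtain ⟨x, hx⟩ := hf (of τ χ)
  exact hχ ((DFunLike.congr_fun hx m).symm.trans (DFunLike.congr_fun hm x))

theorem injective_of_projective [Module.Projective A M] : Module.Injective B (CharDual τ M) where
  out X Y _ _ _ _ i hi f := by
    obtain ⟨g, hg⟩ := Module.projective_lifting_property (map (swapOp τ) i) (transpose f)
      (map_surjective hi)
    refine ⟨transpose.symm g, fun x ↦ ?_⟩
    ext m
    exact DFunLike.congr_fun (DFunLike.congr_fun hg m) x

end Functoriality

section LinearSystems

variable {r q s : ℕ}

variable (τ) in
/-- The transposed matrix, over the ring acting on the character modules. -/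
def dualMatrix (T : Matrix (Fin r) (Fin q) A) : Matrix (Fin q) (Fin r) B :=
  T.transpose.map fun a ↦ (τ a).unop

@[simp] theorem dualMatrix_swapOp_dualMatrix (T : Matrix (Fin r) (Fin q) A) :
    dualMatrix (swapOp τ) (dualMatrix τ T) = T := by
  ext i j
  exact τ.symm_apply_apply (T i j)

variable (τ) in
/-- The perfect pairing between `(M^*)^r` and `M^r`, as a bijection with the characters
of `M^r`. -/
def sumPairing : (Fin r → CharDual τ M) ≃ ((Fin r → M) →+ AddCircle (1 : ℚ)) where
  toFun χ := AddMonoidHom.mk' (fun x ↦ ∑ i, χ i (x i)) fun x y ↦ by simp [Finset.sum_add_distrib]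
  invFun Φ i := of τ (Φ.comp (AddMonoidHom.single (fun _ ↦ M) i))
  left_inv χ := by
    ext i x
    change ∑ k, χ k (Pi.single (M := fun _ ↦ M) i x k) = χ i x
    rw [Finset.sum_eq_single i (fun k _ hk ↦ by rw [Pi.single_eq_of_ne hk, map_zero]) (by simp),
      Pi.single_eq_same]
  right_inv Φ := by
    refine DFunLike.ext _ _ fun x ↦ ?_
    change ∑ i, Φ (Pi.single i (x i)) = Φ x
    rw [← map_sum, Finset.univ_sum_single]

theorem sumPairing_apply (χ : Fin r → CharDual τ M) (x : Fin r → M) :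
    sumPairing τ χ x = ∑ i, χ i (x i) := rfl

variable [Module A M]

theorem sumPairing_matrixHom_dualMatrix (T : Matrix (Fin r) (Fin q) A) (χ : Fin r → CharDual τ M) :
    sumPairing τ (matrixHom (dualMatrix τ T) (CharDual τ M) χ) =
      (sumPairing τ χ).comp (matrixHom T M) := by
  refine DFunLike.ext _ _ fun x ↦ ?_
  simp only [sumPairing_apply, AddMonoidHom.comp_apply, matrixHom_apply, dualMatrix, sum_apply,
    map_sum, Matrix.map_apply, Matrix.transpose_apply, unop_smul_apply]
  exact Finset.sum_comm

theorem matrixHom_dualMatrix_eq_zero_iff (T : Matrix (Fin r) (Fin q) A)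
    (χ : Fin r → CharDual τ M) : matrixHom (dualMatrix τ T) (CharDual τ M) χ = 0 ↔
      (matrixHom T M).range ≤ (sumPairing τ χ).ker := by
  have hzero : sumPairing τ (0 : Fin q → CharDual τ M) = 0 :=
    DFunLike.ext _ _ fun x ↦ by simp [sumPairing_apply]
  rw [← (sumPairing τ).apply_eq_iff_eq, hzero, sumPairing_matrixHom_dualMatrix,
    AddMonoidHom.range_le_ker_iff]

theorem isPureMap_eval : IsPureMap (eval τ M) := by
  intro r q T y z hz
  by_contra! hy
  obtain ⟨Φ, hΦ, hΦy⟩ := exists_character_eq_zero_ne_zero (matrixHom T M).range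
    (x := y) (by rintro ⟨x, hx⟩; exact hy x hx)
  obtain ⟨χ, rfl⟩ := (sumPairing τ).surjective Φ
  have hχ : matrixHom (dualMatrix τ T) (CharDual τ M) χ = 0 :=
    (matrixHom_dualMatrix_eq_zero_iff T χ).2 hΦ
  refine hΦy ?_
  calc sumPairing τ χ y
      = sumPairing (swapOp τ) (matrixHom T _ z) χ := by rw [hz]; rfl
    _ = sumPairing (swapOp τ) z (matrixHom (dualMatrix τ T) _ χ) := by
        conv_lhs => rw [← dualMatrix_swapOp_dualMatrix (τ := τ) T, sumPairing_matrixHom_dualMatrix]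
        rfl
    _ = 0 := by rw [hχ, map_zero]

theorem exact_dualMatrix {T : Matrix (Fin r) (Fin q) A} {S : Matrix (Fin s) (Fin r) A}
    (h : Function.Exact (matrixHom T M) (matrixHom S M)) :
    Function.Exact (matrixHom (dualMatrix τ S) (CharDual τ M))
      (matrixHom (dualMatrix τ T) (CharDual τ M)) := fun χ ↦ by
  rw [matrixHom_dualMatrix_eq_zero_iff, ← AddMonoidHom.exact_iff.1 h]
  constructor
  · intro hχ
    obtain ⟨Ψ, hΨ⟩ := exists_character_factorization _ _ hχ
    obtain ⟨ψ, rfl⟩ := (sumPairing τ).surjective Ψ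
    exact ⟨ψ, (sumPairing τ).injective ((sumPairing_matrixHom_dualMatrix S ψ).trans hΨ)⟩
  · rintro ⟨ψ, rfl⟩
    rw [sumPairing_matrixHom_dualMatrix]
    exact fun y hy ↦ (congrArg (sumPairing τ ψ) hy).trans (map_zero _)

theorem exact_doubleDual {T : Matrix (Fin r) (Fin q) A} {S : Matrix (Fin s) (Fin r) A}
    (h : Function.Exact (matrixHom T M) (matrixHom S M)) :
    Function.Exact (matrixHom T (CharDual (swapOp τ) (CharDual τ M)))
      (matrixHom S (CharDual (swapOp τ) (CharDual τ M))) := by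
  simpa only [dualMatrix_swapOp_dualMatrix] using
    exact_dualMatrix (τ := swapOp τ) (exact_dualMatrix (τ := τ) h)

end LinearSystems

end CharDual

section Presentation

variable {A : Type u} [Ring A] {M X : Type u} [AddCommGroup M] [Module A M] [AddCommGroup X]
  [Module A X]

theorem exists_linearMap_iff_matrixHom_eq_zero {r s : ℕ} {k : Fin r → X}
    (hk : Submodule.span A (Set.range k) = ⊤) {S : Matrix (Fin s) (Fin r) A}
    (hS : Submodule.span A (Set.range S.row) = (Fintype.linearCombination A k).ker)
    (y : Fin r → M) :
    (∃ f : X →ₗ[A] M, ∀ j, f (k j) = y j) ↔ matrixHom S M y = 0 := by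
  have hker : matrixHom S M y = 0 ↔
      (Fintype.linearCombination A k).ker ≤ (Fintype.linearCombination A y).ker := by
    rw [← hS, Submodule.span_le, Set.range_subset_iff, funext_iff]
    rfl
  rw [hker]
  constructor
  · rintro ⟨f, hf⟩ c (hc : ∑ j, c j • k j = 0)
    simpa [hf, Fintype.linearCombination_apply] using congrArg f hc
  · intro h
    let e := (Fintype.linearCombination A k).quotKerEquivOfSurjective
      (by rw [← LinearMap.range_eq_top, Fintype.range_linearCombination, hk])
    refine ⟨Submodule.liftQ _ _ h ∘ₗ e.symm.toLinearMap, fun j ↦ ?_⟩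
    have hj : e (Submodule.Quotient.mk (Pi.single j 1)) = k j :=
      (Fintype.linearCombination_apply_single A k j 1).trans (one_smul A _)
    simp [← hj]

variable (X) in
theorem exists_finite_presentation [IsNoetherianRing A] [Module.Finite A X] :
    ∃ (r s : ℕ) (k : Fin r → X) (S : Matrix (Fin s) (Fin r) A),
      Submodule.span A (Set.range k) = ⊤ ∧
        Submodule.span A (Set.range S.row) = (Fintype.linearCombination A k).ker := by
  obtain ⟨r, k, hk⟩ := Module.Finite.exists_fin (R := A) (M := X)
  obtain ⟨s, S, hS⟩ := Submodule.fg_iff_exists_fin_generating_family.1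
    (IsNoetherian.noetherian (Fintype.linearCombination A k).ker)
  exact ⟨r, s, k, .of S, hk, hS⟩

variable (M) in
theorem exact_matrixHom_ideal_iff {I : Ideal A} {r s : ℕ} {k : Fin r → I}
    (hk : Submodule.span A (Set.range k) = ⊤) {S : Matrix (Fin s) (Fin r) A}
    (hS : Submodule.span A (Set.range S.row) = (Fintype.linearCombination A k).ker) :
    Function.Exact (matrixHom (.of fun j (_ : Fin 1) ↦ (k j : A)) M) (matrixHom S M) ↔
      ∀ f : I →ₗ[A] M, ∃ g : A →ₗ[A] M, g ∘ₗ I.subtype = f := by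
  have hrange (y : Fin r → M) :
      y ∈ Set.range (matrixHom (.of fun j (_ : Fin 1) ↦ (k j : A)) M) ↔
        ∃ g : A →ₗ[A] M, ∀ j, g (k j) = y j := by
    refine ⟨fun ⟨z, hz⟩ ↦ ⟨LinearMap.toSpanSingleton A M (z 0), fun j ↦ ?_⟩,
      fun ⟨g, hg⟩ ↦ ⟨fun _ ↦ g 1, funext fun j ↦ ?_⟩⟩
    · simp [← hz, matrixHom_apply]
    · simp [← hg, matrixHom_apply, ← map_smul]
  simp only [Function.Exact, hrange, ← exists_linearMap_iff_matrixHom_eq_zero hk hS]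
  constructor
  · intro h f
    obtain ⟨g, hg⟩ := (h _).1 ⟨f, fun _ ↦ rfl⟩
    exact ⟨g, LinearMap.ext_on_range hk hg⟩
  · refine fun h y ↦ ⟨?_, fun ⟨g, hg⟩ ↦ ⟨g ∘ₗ I.subtype, hg⟩⟩
    rintro ⟨f, hf⟩
    obtain ⟨g, rfl⟩ := h f
    exact ⟨g, hf⟩

theorem CharDual.injective_doubleDual [IsNoetherianRing A] {B : Type u} [Ring B] {τ : A ≃+* Bᵐᵒᵖ}
    [Module.Injective A M] : Module.Injective A (CharDual (swapOp τ) (CharDual τ M)) := by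
  refine Module.Baer.injective fun I f ↦ ?_
  obtain ⟨r, s, k, S, hk, hS⟩ := exists_finite_presentation (A := A) I
  have hM := (exact_matrixHom_ideal_iff M hk hS).2 fun f ↦
    Module.Injective.extension_property A M I A I.subtype I.injective_subtype f
  obtain ⟨g, rfl⟩ := (exact_matrixHom_ideal_iff _ hk hS).1 (exact_doubleDual (τ := τ) hM) f
  exact ⟨g, fun _ _ ↦ rfl⟩

end Presentation

/-! ### Injective dimension and Iwanaga duality -/

section InjectiveDimension

open Abelian

variable {A : Type u} [Ring A]

theorem exists_shortExact_finite [IsNoetherianRing A] (N : ModuleCat.{u} A) [Module.Finite A N] :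
    ∃ (K : ModuleCat.{u} A) (q : ℕ) (i : K ⟶ ModuleCat.of A (Fin q → A))
      (p : ModuleCat.of A (Fin q → A) ⟶ N) (w : i ≫ p = 0), Module.Finite A K ∧
        (ShortComplex.mk i p w).ShortExact := by
  obtain ⟨q, f, hf⟩ := Module.Finite.exists_fin' A N
  exact ⟨_, q, _, _, _, inferInstanceAs (Module.Finite A f.ker),
    LinearMap.shortExact_shortComplexKer hf⟩

theorem hasInjectiveDimensionLT_of_subsingleton_ext_finite (n : ℕ) (M : ModuleCat.{u} A)
    (h : ∀ N : ModuleCat.{u} A, Module.Finite A N → Subsingleton (Ext N M (n + 1))) :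
    HasInjectiveDimensionLT M (n + 1) := by
  induction n generalizing M with
  | zero =>
    suffices Injective M from inferInstance
    refine (Module.injective_iff_injective_object A M).1 (Module.Baer.injective fun I f ↦ ?_)
    have hS := ModuleCat.shortComplex_shortExact (ModuleCat.shortComplexOfCompEqZero I.subtype I.mkQ
      (LinearMap.exact_subtype_mkQ I).linearMap_comp_eq_zero) (LinearMap.exact_subtype_mkQ I)
      I.injective_subtype I.mkQ_surjective
    obtain ⟨g, hg⟩ := exists_extension_of_subsingleton_ext_one hS
      (h _ (inferInstanceAs (Module.Finite A (A ⧸ I)))) (ModuleCat.ofHom f)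
    exact ⟨g.hom, fun x hx ↦ congrArg (fun k ↦ k.hom ⟨x, hx⟩) hg⟩
  | succ n ih =>
    obtain ⟨I, K, i, p, w, hI, hS⟩ := exists_shortExact_injective M
    refine (hS.hasInjectiveDimensionLT_X₃_iff n hI).1 (ih K fun N hN ↦ ?_)
    exact subsingleton_ext_to_X₃ hS (n + 1) N (h N hN) (Ext.subsingleton_of_injective _ _ _)

theorem IsPureMap.subsingleton_ext [IsNoetherianRing A] {M N : ModuleCat.{u} A} {u : M →ₗ[A] N}
    (hu : IsPureMap u) (X : ModuleCat.{u} A) [Module.Finite A X] (n : ℕ)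
    (hX : Subsingleton (Ext X N (n + 1))) : Subsingleton (Ext X M (n + 1)) := by
  induction n generalizing X with
  | zero =>
    obtain ⟨K, q, i, p, w, hK, hS⟩ := exists_shortExact_finite X
    have hF : Projective (ModuleCat.of A (Fin q → A)) := inferInstance
    refine subsingleton_ext_one_of_exists_extension hS (Ext.subsingleton_of_projective _ _ _)
      fun f ↦ ?_
    obtain ⟨g, hg⟩ := exists_extension_of_subsingleton_ext_one hS hX (f ≫ ModuleCat.ofHom u)
    obtain ⟨h, hh⟩ := hu.exists_extension i.hom f.hom g.hom (congrArg ModuleCat.Hom.hom hg)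
    exact ⟨ModuleCat.ofHom h, ModuleCat.hom_ext hh⟩
  | succ n ih =>
    obtain ⟨K, q, i, p, w, hK, hS⟩ := exists_shortExact_finite X
    have hF : Projective (ModuleCat.of A (Fin q → A)) := inferInstance
    exact subsingleton_ext_X₃ hS (n + 1) M
      (ih K (subsingleton_ext_X₁ hS (n + 1) N (Ext.subsingleton_of_projective _ _ _) hX))
      (Ext.subsingleton_of_projective _ _ _)

theorem IsPureMap.hasInjectiveDimensionLT [IsNoetherianRing A] {M N : ModuleCat.{u} A}
    {u : M →ₗ[A] N} (hu : IsPureMap u) (n : ℕ) (hN : HasInjectiveDimensionLT N (n + 1)) :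
    HasInjectiveDimensionLT M (n + 1) :=
  hasInjectiveDimensionLT_of_subsingleton_ext_finite n M fun X _ ↦ hu.subsingleton_ext X n
    (hN.subsingleton N (n + 1) _ le_rfl X)

theorem hasInjectiveDimensionLT_pi (ι : Type u) (n : ℕ) {M : ModuleCat.{u} A}
    (hM : HasInjectiveDimensionLT M (n + 1)) :
    HasInjectiveDimensionLT (ModuleCat.of A (ι → M)) (n + 1) := by
  refine hasInjectiveDimensionLT_of_exact_of_injective
    (fun M : ModuleCat.{u} A ↦ ModuleCat.of A (ι → M)) (fun J hJ ↦ ?_) (fun S hS ↦ ?_) n hM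
  · have := Module.injective_module_of_injective_object A J
    exact (Module.injective_iff_injective_object A (ι → J)).1 inferInstance
  · have hex := (ShortComplex.ShortExact.moduleCat_exact_iff_function_exact _).1 hS.exact
    refine ⟨ModuleCat.ofHom (S.f.hom.compLeft ι), ModuleCat.ofHom (S.g.hom.compLeft ι), ?_,
      ModuleCat.shortComplex_shortExact _ (fun x ↦ ?_) hS.moduleCat_injective_f.comp_left
      hS.moduleCat_surjective_g.comp_left⟩
    · exact ModuleCat.hom_ext (LinearMap.ext fun x ↦ funext fun a ↦ hex.apply_apply_eq_zero (x a))
    · refine (funext_iff.trans (forall_congr' fun a ↦ hex (x a))).trans ?_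
      exact Classical.skolem.trans (exists_congr fun y ↦ funext_iff.symm)

theorem hasInjectiveDimensionLT_of_projective [IsNoetherianRing A] (n : ℕ)
    (hA : HasInjectiveDimensionLT (ModuleCat.of A A) (n + 1)) (Q : ModuleCat.{u} A)
    [Projective Q] : HasInjectiveDimensionLT Q (n + 1) := by
  have : Module.Projective A Q := inferInstance
  obtain ⟨s, hs⟩ := Module.projective_def.1 this
  have R : Retract Q (ModuleCat.of A (Q →₀ A)) :=
    ⟨ModuleCat.ofHom s, ModuleCat.ofHom (Finsupp.linearCombination A id),
      ModuleCat.hom_ext (LinearMap.ext hs)⟩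
  have hfree : HasInjectiveDimensionLT (ModuleCat.of A (Q →₀ A)) (n + 1) :=
    (isPureMap_finsupp Q A).hasInjectiveDimensionLT n (hasInjectiveDimensionLT_pi Q n hA)
  exact R.hasInjectiveDimensionLT (n + 1)

end InjectiveDimension

namespace CharDual

open Abelian

variable {A B : Type u} [Ring A] [Ring B] (τ : A ≃+* Bᵐᵒᵖ)

/-- The action on objects of the functor of character modules, for use with homological algebra in
`ModuleCat`. -/
abbrev obj (M : ModuleCat.{u} A) : ModuleCat.{u} B := ModuleCat.of B (CharDual τ M)

theorem shortExact_map {S : ShortComplex (ModuleCat.{u} A)} (hS : S.ShortExact) :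
    (ShortComplex.mk (X₁ := obj τ S.X₃) (X₂ := obj τ S.X₂) (X₃ := obj τ S.X₁)
      (ModuleCat.ofHom (map τ S.g.hom)) (ModuleCat.ofHom (map τ S.f.hom))
      (ModuleCat.hom_ext (map_exact ((ShortComplex.ShortExact.moduleCat_exact_iff_function_exact
        _).1 hS.exact)).linearMap_comp_eq_zero)).ShortExact :=
  ModuleCat.shortComplex_shortExact _
    (map_exact ((ShortComplex.ShortExact.moduleCat_exact_iff_function_exact _).1 hS.exact))
    (map_injective hS.moduleCat_surjective_g) (map_surjective hS.moduleCat_injective_f)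

theorem injective_obj_of_projective (P : ModuleCat.{u} A) [Projective P] : Injective (obj τ P) :=
  have : Module.Projective A P := inferInstance
  (Module.injective_iff_injective_object B (CharDual τ P)).1 injective_of_projective

theorem hasInjectiveDimensionLT_obj (n : ℕ) {M : ModuleCat.{u} A}
    (hM : HasProjectiveDimensionLT M (n + 1)) : HasInjectiveDimensionLT (obj τ M) (n + 1) := by
  induction n generalizing M with
  | zero =>
    have : Projective M := projective_iff_hasProjectiveDimensionLT_one.2 hM
    have := injective_obj_of_projective τ M
    infer_instance
  | succ n ih =>
    obtain ⟨K, P, i, p, w, hP, hS⟩ := exists_isSyzygy M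
    have hK := ih ((hS.hasProjectiveDimensionLT_X₃_iff n hP).1 hM)
    have hPinj := injective_obj_of_projective τ P
    exact ((shortExact_map τ hS).hasInjectiveDimensionLT_X₃_iff n hPinj).1 hK

theorem hasInjectiveDimensionLT_doubleDual [IsNoetherianRing A] (n : ℕ) {M : ModuleCat.{u} A}
    (hM : HasInjectiveDimensionLT M (n + 1)) :
    HasInjectiveDimensionLT (obj (swapOp τ) (obj τ M)) (n + 1) := by
  refine hasInjectiveDimensionLT_of_exact_of_injective (fun M ↦ obj (swapOp τ) (obj τ M))
    (fun J hJ ↦ ?_) (fun S hS ↦ ⟨_, _, _, shortExact_map (swapOp τ) (shortExact_map τ hS)⟩) n hM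
  have := Module.injective_module_of_injective_object A J
  exact (Module.injective_iff_injective_object A _).1 injective_doubleDual

theorem hasInjectiveDimensionLT_of_doubleDual [IsNoetherianRing A] (n : ℕ) {M : ModuleCat.{u} A}
    (hM : HasInjectiveDimensionLT (obj (swapOp τ) (obj τ M)) (n + 1)) :
    HasInjectiveDimensionLT M (n + 1) :=
  (isPureMap_eval (τ := τ)).hasInjectiveDimensionLT n hM

theorem subsingleton_ext_obj (n : ℕ) (X : ModuleCat.{u} A) (N : ModuleCat.{u} B)
    (hX : HasInjectiveDimensionLT (obj τ X) (n + 1)) :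
    Subsingleton (Ext X (obj (swapOp τ) N) (n + 1)) := by
  induction n generalizing X with
  | zero =>
    have hinj : Injective (obj τ X) := injective_iff_hasInjectiveDimensionLT_one.2 hX
    obtain ⟨K, P, i, p, w, hP, hS⟩ := exists_isSyzygy X
    refine subsingleton_ext_one_of_exists_extension hS (Ext.subsingleton_of_projective _ _ _)
      fun f ↦ ?_
    obtain ⟨g, hg⟩ := exists_lift_of_subsingleton_ext_one (shortExact_map τ hS)
      (Ext.subsingleton_of_injective N _ _) (ModuleCat.ofHom (transpose.symm f.hom))
    refine ⟨ModuleCat.ofHom (transpose g.hom), ModuleCat.hom_ext (LinearMap.ext fun x ↦ ?_)⟩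
    refine CharDual.ext (τ := swapOp τ) fun y ↦ ?_
    exact DFunLike.congr_fun (ConcreteCategory.congr_hom hg y) x
  | succ n ih =>
    obtain ⟨K, P, i, p, w, hP, hS⟩ := exists_isSyzygy X
    have hK := ((shortExact_map τ hS).hasInjectiveDimensionLT_X₃_iff n
      (injective_obj_of_projective τ P)).2 hX
    exact subsingleton_ext_X₃ hS (n + 1) _ (ih K hK) (Ext.subsingleton_of_projective _ _ _)

end CharDual

section Iwanaga

open CharDual Abelian

variable {A B : Type u} [Ring A] [Ring B] (τ : A ≃+* Bᵐᵒᵖ)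

theorem hasInjectiveDimensionLT_obj_of_injective [IsNoetherianRing B] (n : ℕ)
    (hB : HasInjectiveDimensionLT (ModuleCat.of B B) (n + 1)) (J : ModuleCat.{u} A)
    [Injective J] : HasInjectiveDimensionLT (obj τ J) (n + 1) := by
  obtain ⟨K, F, i, p, w, hF, hS⟩ := exists_isSyzygy (obj τ J)
  let j : J ⟶ obj (swapOp τ) F := ModuleCat.ofHom (transpose p.hom)
  have hj : Mono j := (ModuleCat.mono_iff_injective _).2
    (transpose_injective_of_surjective hS.moduleCat_surjective_g)
  let r := Injective.factorThru (𝟙 J) j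
  have hr (x : J) : r (j x) = x :=
    ConcreteCategory.congr_hom (Injective.comp_factorThru (𝟙 J) j) x
  have R : Retract (obj τ J) (obj τ (obj (swapOp τ) F)) :=
    ⟨ModuleCat.ofHom (map τ r.hom), ModuleCat.ofHom (map τ j.hom), ModuleCat.hom_ext <|
      LinearMap.ext fun χ ↦ ext fun x ↦ congrArg χ (hr x)⟩
  have hF' : HasInjectiveDimensionLT (obj τ (obj (swapOp τ) F)) (n + 1) :=
    hasInjectiveDimensionLT_doubleDual (swapOp τ) n (hasInjectiveDimensionLT_of_projective n hB F)
  exact R.hasInjectiveDimensionLT (n + 1)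

include τ

theorem hasInjectiveDimensionLT_of_hasInjectiveDimensionLT_add [IsNoetherianRing A]
    [IsNoetherianRing B] (n k : ℕ) (hB : HasInjectiveDimensionLT (ModuleCat.of B B) (n + 1))
    {M : ModuleCat.{u} A} (hM : HasInjectiveDimensionLT M (n + 1 + k)) :
    HasInjectiveDimensionLT M (n + 1) := by
  refine hasInjectiveDimensionLT_of_doubleDual τ n
    (hasInjectiveDimensionLT_of_subsingleton_ext_injective (n + 1) k ?_ fun J _ i hi ↦ ?_)
  · rw [add_right_comm] at hM ⊢
    exact hasInjectiveDimensionLT_doubleDual τ (n + k) hM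
  · obtain ⟨i, rfl⟩ := Nat.exists_eq_add_of_le hi
    rw [add_right_comm]
    have := hasInjectiveDimensionLT_obj_of_injective τ n hB J
    exact subsingleton_ext_obj τ (n + i) J _ (hasInjectiveDimensionLT_of_ge _ (n + 1) _ (by lia))

theorem hasProjectiveDimensionLT_of_hasInjectiveDimensionLT [IsNoetherianRing A]
    [IsNoetherianRing B] (m n : ℕ) (hA : HasInjectiveDimensionLT (ModuleCat.of A A) (m + 1))
    (hB : HasInjectiveDimensionLT (ModuleCat.of B B) (n + 1)) {M : ModuleCat.{u} A}
    (hM : HasInjectiveDimensionLT M (n + 1)) : HasProjectiveDimensionLT M (n + 1) := by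
  refine hasProjectiveDimensionLT_of_isSyzygy_closed
    (P := fun L ↦ HasInjectiveDimensionLT L (n + 1))
    (fun K L ⟨P, i, p, w, hP, hS⟩ hL ↦ ?_) n hM
    fun L hL ↦ HasInjectiveDimensionLT.subsingleton L (n + 1) _ le_rfl M
  have := hasInjectiveDimensionLT_of_projective m hA P
  have := hasInjectiveDimensionLT_of_hasInjectiveDimensionLT_add τ n (m + 1) hB
    (M := P) (hasInjectiveDimensionLT_of_ge _ (m + 1) _ (by lia))
  exact hasInjectiveDimensionLT_of_hasInjectiveDimensionLT_add τ n 1 hB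
    (hS.hasInjectiveDimensionLT_X₁ (n + 1) hL
      (hasInjectiveDimensionLT_of_ge P (n + 1) _ (by lia)))

theorem hasInjectiveDimensionLT_self_of_injective [IsNoetherianRing B] (n : ℕ)
    (h : ∀ J : ModuleCat.{u} A, Injective J → HasProjectiveDimensionLT J (n + 1)) :
    HasInjectiveDimensionLT (ModuleCat.of B B) (n + 1) :=
  hasInjectiveDimensionLT_of_doubleDual (swapOp τ) n
    (hasInjectiveDimensionLT_obj τ n (h _ (injective_obj_of_projective (swapOp τ) _)))

end Iwanaga

/-! ### Pushouts and pullbacks of short exact sequences -/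

section DiagramChase

open Limits Abelian

universe w v' u'

variable {C : Type u'} [Category.{v'} C] [Abelian C]

section Pushout

variable {S : ShortComplex C} (hS : S.ShortExact)

include hS

theorem exists_shortExact_of_isPushout {L W : C} {f : S.X₁ ⟶ L} {a : S.X₂ ⟶ W} {b : L ⟶ W}
    (sq : IsPushout S.f f a b) :
    ∃ (q : W ⟶ S.X₃) (h : b ≫ q = 0), (ShortComplex.mk b q h).ShortExact := by
  have := hS.mono_f
  have := hS.epi_g
  let q := sq.desc S.g 0 (by simp)
  have haq : a ≫ q = S.g := sq.inl_desc ..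
  have hbq : b ≫ q = 0 := sq.inr_desc ..
  have hq : Epi q := epi_of_epi_fac haq
  have hcoker : IsColimit (CokernelCofork.ofπ q hbq) := CokernelCofork.IsColimit.ofπ' _ _
    fun k hk ↦ by
      have hak : S.f ≫ a ≫ k = 0 := by rw [sq.w_assoc, hk, comp_zero]
      exact ⟨hS.exact.desc (a ≫ k) hak, sq.hom_ext
        (by rw [reassoc_of% haq, hS.exact.g_desc]) (by rw [reassoc_of% hbq, hk, zero_comp])⟩
  exact ⟨q, hbq, {
    exact := ShortComplex.exact_of_g_is_cokernel _ hcoker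
    mono_f := mono_inr_of_isColimit _ _ sq.isColimit
    epi_g := hq }⟩

theorem shortExact_comp_of_isPushout {Q Y : C} {j : S.X₂ ⟶ Q} [Mono j] {n : S.X₃ ⟶ Y} {a : Q ⟶ Y}
    (sq : IsPushout S.g j n a) :
    (ShortComplex.mk (S.f ≫ j) a (by simp [← sq.w])).ShortExact := by
  have := hS.mono_f
  have := hS.epi_g
  have ha : Epi a := sq.epi_inr_of_epi
  have hcoker : IsColimit (CokernelCofork.ofπ (f := S.f ≫ j) a (by simp [← sq.w])) :=
    CokernelCofork.IsColimit.ofπ' _ _ fun k hk ↦ by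
      rw [Category.assoc] at hk
      exact ⟨sq.desc (hS.exact.desc (j ≫ k) hk) k (hS.exact.g_desc ..), sq.inr_desc ..⟩
  exact { exact := ShortComplex.exact_of_g_is_cokernel _ hcoker, mono_f := mono_comp _ _ }

theorem exists_shortExact_of_isPullback {Q W : C} {q : W ⟶ Q} {r : W ⟶ S.X₂} {f : Q ⟶ S.X₃}
    (sq : IsPullback q r f S.g) :
    ∃ (a : S.X₁ ⟶ W) (h : a ≫ q = 0), (ShortComplex.mk a q h).ShortExact := by
  obtain ⟨a, h, hW⟩ := exists_shortExact_of_isPushout hS.op sq.op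
  exact ⟨a.unop, congrArg Quiver.Hom.unop h, hW.unop⟩

theorem shortExact_comp_of_isPullback {L Y : C} {j : L ⟶ S.X₂} [Epi j] {a : Y ⟶ L} {n : Y ⟶ S.X₁}
    (sq : IsPullback a n j S.f) :
    (ShortComplex.mk a (j ≫ S.g) (by simp [sq.w_assoc])).ShortExact :=
  have : Mono (X := S.op.X₂) j.op := inferInstanceAs (Mono j.op)
  (shortExact_comp_of_isPushout hS.op sq.op).unop

end Pushout

variable {K E N : C} {i : K ⟶ E} {p : E ⟶ N} {w : i ≫ p = 0}
  (hS : (ShortComplex.mk i p w).ShortExact)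

include hS

theorem exists_pushout {L D : C} {f : K ⟶ L} {c : L ⟶ D} {w' : f ≫ c = 0}
    (hT : (ShortComplex.mk f c w').ShortExact) :
    ∃ (W : C) (a : E ⟶ W) (b : L ⟶ W) (q : W ⟶ N) (r : W ⟶ D) (h : b ≫ q = 0) (h' : a ≫ r = 0),
      (ShortComplex.mk b q h).ShortExact ∧ (ShortComplex.mk a r h').ShortExact := by
  have sq := IsPushout.of_hasPushout i f
  obtain ⟨q, h, hW⟩ := exists_shortExact_of_isPushout hS sq
  obtain ⟨r, h', hW'⟩ := exists_shortExact_of_isPushout hT sq.flip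
  exact ⟨_, _, _, q, r, h, h', hW, hW'⟩

theorem exists_pullback {L Q : C} {j : L ⟶ Q} {f : Q ⟶ N} {w' : j ≫ f = 0}
    (hT : (ShortComplex.mk j f w').ShortExact) :
    ∃ (W : C) (a : K ⟶ W) (b : L ⟶ W) (q : W ⟶ Q) (r : W ⟶ E) (h : a ≫ q = 0) (h' : b ≫ r = 0),
      (ShortComplex.mk a q h).ShortExact ∧ (ShortComplex.mk b r h').ShortExact := by
  have sq := IsPullback.of_hasPullback f p
  obtain ⟨a, h, hW⟩ := exists_shortExact_of_isPullback hS sq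
  obtain ⟨b, h', hW'⟩ := exists_shortExact_of_isPullback hT sq.flip
  exact ⟨_, a, b, _, _, h, h', hW, hW'⟩

theorem exists_shortExact_comp_mono {Q D : C} {j : E ⟶ Q} {q : Q ⟶ D} {w' : j ≫ q = 0}
    (hT : (ShortComplex.mk j q w').ShortExact) :
    ∃ (Y : C) (π : Q ⟶ Y) (n : N ⟶ Y) (r : Y ⟶ D) (h : (i ≫ j) ≫ π = 0) (h' : n ≫ r = 0),
      (ShortComplex.mk (i ≫ j) π h).ShortExact ∧ (ShortComplex.mk n r h').ShortExact := by
  have sq := IsPushout.of_hasPushout p j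
  have : Mono j := hT.mono_f
  obtain ⟨r, h', hY⟩ := exists_shortExact_of_isPushout hT sq.flip
  exact ⟨_, _, _, r, _, h', shortExact_comp_of_isPushout hS sq, hY⟩

theorem exists_shortExact_comp_epi {L D : C} {j : L ⟶ N} {q : N ⟶ D} {w' : j ≫ q = 0}
    (hT : (ShortComplex.mk j q w').ShortExact) :
    ∃ (Y : C) (ι : Y ⟶ E) (n : K ⟶ Y) (r : Y ⟶ L) (h : ι ≫ p ≫ q = 0) (h' : n ≫ r = 0),
      (ShortComplex.mk ι (p ≫ q) h).ShortExact ∧ (ShortComplex.mk n r h').ShortExact := by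
  have sq := IsPullback.of_hasPullback p j
  have : Epi p := hS.epi_g
  obtain ⟨n, h', hY⟩ := exists_shortExact_of_isPullback hS sq.flip
  exact ⟨_, _, n, _, _, h', shortExact_comp_of_isPullback hT sq, hY⟩

theorem exists_isSyzygy_left {D : C} (h : IsSyzygy E D) :
    ∃ (Y : C) (n : N ⟶ Y) (r : Y ⟶ D) (h' : n ≫ r = 0),
      IsSyzygy K Y ∧ (ShortComplex.mk n r h').ShortExact := by
  obtain ⟨Q, j, q, w', hQ, hT⟩ := h
  obtain ⟨Y, π, n, r, h, h', hY, hY'⟩ := exists_shortExact_comp_mono hS hT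
  exact ⟨Y, n, r, h', ⟨Q, _, π, h, hQ, hY⟩, hY'⟩

theorem exists_shortExact_swap_of_retraction {r : E ⟶ K} (hr : i ≫ r = 𝟙 K) :
    ∃ (s : N ⟶ E) (h : s ≫ r = 0), (ShortComplex.mk s r h).ShortExact := by
  have := hS.epi_g
  let σ := ShortComplex.Splitting.ofExactOfRetraction _ hS.exact r hr this
  exact ⟨σ.s, σ.s_r, ShortComplex.Splitting.shortExact
    { r := p, s := i, f_r := σ.s_g, s_g := hr, id := by rw [add_comm]; exact σ.id }⟩

/-- Embed `K` and `N` in projectives `Q₁` and `Q₂`. The pushout of `E` along `K ⟶ Q₁` is an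
extension of `N` by `Q₁`, hence split, and pushing it out along `N ⟶ Q₂` gives a projective. -/
theorem exists_isSyzygy_extension [HasExt.{w} C] {C₁ C₂ : C} (h₁ : IsSyzygy K C₁)
    (h₂ : IsSyzygy N C₂) (hN : ∀ Q : C, Projective Q → Subsingleton (Ext N Q 1)) :
    ∃ (D : C) (f : C₁ ⟶ D) (g : D ⟶ C₂) (h : f ≫ g = 0),
      IsSyzygy E D ∧ (ShortComplex.mk f g h).ShortExact := by
  obtain ⟨Q₁, i₁, p₁, w₁, hQ₁, hS₁⟩ := h₁
  obtain ⟨Q₂, i₂, p₂, w₂, hQ₂, hS₂⟩ := h₂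
  obtain ⟨W, a, b, q, r, h, h', hW, hE⟩ := exists_pushout hS hS₁
  obtain ⟨ρ, hρ⟩ := exists_extension_of_subsingleton_ext_one hW (hN Q₁ hQ₁) (𝟙 Q₁)
  obtain ⟨s, hs, hW'⟩ := exists_shortExact_swap_of_retraction hW hρ
  obtain ⟨V, c, d, t, u, k, k', hV, hWV⟩ := exists_pushout hW' hS₂
  have hproj : Projective V := projective_iff_hasProjectiveDimensionLT_one.2 <|
    hV.hasProjectiveDimensionLT_X₂ 1 (projective_iff_hasProjectiveDimensionLT_one.1 hQ₂)
      (projective_iff_hasProjectiveDimensionLT_one.1 hQ₁)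
  exact exists_isSyzygy_left hE ⟨V, c, u, k', hproj, hWV⟩

end DiagramChase

/-! ### Finite projective dimension and special precovers -/

section FiniteProjectiveDimension

open Abelian ZeroObject

universe w v' u'

variable {C : Type u'} [Category.{v'} C] [Abelian C]

section ExtProjVanishes

variable [HasExt.{w} C]

/-- The condition `Ext^i(M, Q) = 0` for all projective objects `Q` and all `i > k`. It measures how
far `M` is from being Gorenstein-projective, and for `k = 0` is half of the definition. -/
def ExtProjVanishes (k : ℕ) (M : C) : Prop :=
  ∀ Q : C, Projective Q → ∀ i, k < i → Subsingleton (Ext M Q i)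

namespace ExtProjVanishes

variable {k l : ℕ}

theorem of_projective {P : C} (hP : Projective P) (k : ℕ) : ExtProjVanishes k P :=
  fun Q _ i hi ↦ by
    obtain ⟨i, rfl⟩ := Nat.exists_eq_add_of_lt hi
    exact Ext.subsingleton_of_projective P Q _

theorem of_retract {M N : C} (r : Retract M N) (hN : ExtProjVanishes k N) : ExtProjVanishes k M :=
  fun Q hQ n hn ↦ subsingleton_ext_of_retract r Q n (hN Q hQ n hn)

variable {S : ShortComplex C} (hS : S.ShortExact)

include hS

theorem extension (h₁ : ExtProjVanishes k S.X₁) (h₃ : ExtProjVanishes k S.X₃) :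
    ExtProjVanishes k S.X₂ :=
  fun Q hQ n hn ↦ subsingleton_ext_X₂ hS n Q (h₁ Q hQ n hn) (h₃ Q hQ n hn)

theorem kernel (h₂ : ExtProjVanishes l S.X₂) (h₃ : ExtProjVanishes k S.X₃) (hkl : k ≤ l + 1) :
    ExtProjVanishes l S.X₁ :=
  fun Q hQ n hn ↦ subsingleton_ext_X₁ hS n Q (h₂ Q hQ n hn) (h₃ Q hQ _ (by lia))

end ExtProjVanishes

end ExtProjVanishes

/-- `M` has finite projective dimension; the zero object is included. -/
def HasFiniteProjectiveDimension (M : C) : Prop :=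
  ∃ m, HasProjectiveDimensionLT M (m + 1)

namespace HasFiniteProjectiveDimension

theorem of_projective {P : C} (hP : Projective P) : HasFiniteProjectiveDimension P :=
  ⟨0, projective_iff_hasProjectiveDimensionLT_one.1 hP⟩

theorem of_retract {M N : C} (r : Retract M N) (hN : HasFiniteProjectiveDimension N) :
    HasFiniteProjectiveDimension M := by
  obtain ⟨m, hm⟩ := hN
  exact ⟨m, r.hasProjectiveDimensionLT (m + 1)⟩

section ShortExact

variable {S : ShortComplex C} (hS : S.ShortExact)

include hS

theorem kernel (h₂ : HasFiniteProjectiveDimension S.X₂) (h₃ : HasFiniteProjectiveDimension S.X₃) :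
    HasFiniteProjectiveDimension S.X₁ := by
  obtain ⟨a, ha⟩ := h₂
  obtain ⟨b, hb⟩ := h₃
  exact ⟨max a b, hS.hasProjectiveDimensionLT_X₁ _
    (hasProjectiveDimensionLT_of_ge S.X₂ (a + 1) _ (by lia))
    (hasProjectiveDimensionLT_of_ge S.X₃ (b + 1) _ (by lia))⟩

theorem extension (h₁ : HasFiniteProjectiveDimension S.X₁)
    (h₃ : HasFiniteProjectiveDimension S.X₃) : HasFiniteProjectiveDimension S.X₂ := by
  obtain ⟨a, ha⟩ := h₁
  obtain ⟨b, hb⟩ := h₃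
  exact ⟨max a b, hS.hasProjectiveDimensionLT_X₂ _
    (hasProjectiveDimensionLT_of_ge S.X₁ (a + 1) _ (by lia))
    (hasProjectiveDimensionLT_of_ge S.X₃ (b + 1) _ (by lia))⟩

theorem cokernel (h₁ : HasFiniteProjectiveDimension S.X₁)
    (h₂ : HasFiniteProjectiveDimension S.X₂) : HasFiniteProjectiveDimension S.X₃ := by
  obtain ⟨a, ha⟩ := h₁
  obtain ⟨b, hb⟩ := h₂
  exact ⟨max a b + 1, hS.hasProjectiveDimensionLT_X₃ _
    (hasProjectiveDimensionLT_of_ge S.X₁ (a + 1) _ (by lia))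
    (hasProjectiveDimensionLT_of_ge S.X₂ (b + 1) _ (by lia))⟩

end ShortExact

theorem of_isSyzygy {K M : C} (h : IsSyzygy K M) (hM : HasFiniteProjectiveDimension M) :
    HasFiniteProjectiveDimension K := by
  obtain ⟨P, i, p, w, hP, hS⟩ := h
  exact kernel hS (of_projective hP) hM

variable [HasExt.{w} C] [EnoughProjectives C] {M : C} (hM : HasFiniteProjectiveDimension M)

include hM

theorem subsingleton_ext {X : C} {k : ℕ} (hX : ExtProjVanishes k X) (i : ℕ) (hi : k < i) :
    Subsingleton (Ext X M i) := by
  obtain ⟨m, hm⟩ := hM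
  induction m generalizing M i with
  | zero => exact hX M (projective_iff_hasProjectiveDimensionLT_one.2 hm) i hi
  | succ m ih =>
    obtain ⟨K, P, j, p, w, hP, hS⟩ := exists_isSyzygy M
    exact subsingleton_ext_to_X₃ hS i X
      (ih (i + 1) (by lia) ((hS.hasProjectiveDimensionLT_X₃_iff m hP).1 hm)) (hX P hP i hi)

theorem hasProjectiveDimensionLT {k : ℕ} (hk : ExtProjVanishes k M) :
    HasProjectiveDimensionLT M (k + 1) :=
  hasProjectiveDimensionLT_of_isSyzygy_closed (fun _ _ ↦ of_isSyzygy) k hM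
    fun _ hL ↦ hL.subsingleton_ext hk (k + 1) k.lt_succ_self

theorem projective (h : ExtProjVanishes 0 M) : Projective M :=
  projective_iff_hasProjectiveDimensionLT_one.2 (hM.hasProjectiveDimensionLT h)

end HasFiniteProjectiveDimension

section SpecialPrecover

variable [HasExt.{w} C]

/-- `M` is a quotient of an object `G` with `Ext^i(G, Q) = 0` for all projective `Q` and `i > k`,
by a subobject of finite projective dimension. For `k = 0` such an epimorphism `G ⟶ M` is a special
precover by the left orthogonal class of the projective objects. -/
def HasSpecialPrecover (k : ℕ) (M : C) : Prop :=
  ∃ (Y G : C) (i : Y ⟶ G) (p : G ⟶ M) (w : i ≫ p = 0),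
    (ShortComplex.mk i p w).ShortExact ∧ HasFiniteProjectiveDimension Y ∧ ExtProjVanishes k G

namespace HasSpecialPrecover

theorem of_extProjVanishes {k : ℕ} {M : C} (hM : ExtProjVanishes k M) : HasSpecialPrecover k M :=
  ⟨0, M, 0, 𝟙 M, Limits.zero_comp,
    (ShortComplex.Splitting.ofIsZeroOfIsIso (.mk 0 (𝟙 M) Limits.zero_comp)
      (Limits.isZero_zero C) inferInstance).shortExact,
    .of_projective inferInstance, hM⟩

variable [EnoughProjectives C]

/-- Pull back a special precover of `N` to `I`; the kernel of an epimorphism from a projective onto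
the pullback has finite projective dimension, and the kernel of the composite with the projection
onto the special precover is the new middle term. -/
theorem of_succ {k : ℕ} {S : ShortComplex C} (hS : S.ShortExact)
    (h₂ : HasFiniteProjectiveDimension S.X₂) (h₃ : HasSpecialPrecover (k + 1) S.X₃) :
    HasSpecialPrecover k S.X₁ := by
  obtain ⟨Y', G', i', p', w', hS', hY', hG'⟩ := h₃
  obtain ⟨W, a, b, q, r, h, h', hWG, hWI⟩ := exists_pullback hS hS'
  obtain ⟨Y, hYW⟩ := exists_isSyzygy W
  have hY : HasFiniteProjectiveDimension Y := .of_isSyzygy hYW (.extension hWI hY' h₂)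
  obtain ⟨P, j, s, hjs, hP, hPW⟩ := hYW
  obtain ⟨G, ι, m, s', hι, hm, hG, hGY⟩ := exists_shortExact_comp_epi hPW hWG
  exact ⟨Y, G, m, s', hm, hGY, hY, .kernel hG (.of_projective hP _) hG' le_rfl⟩

theorem zero_of_forall [EnoughInjectives C] {n : ℕ} (hn : ∀ M : C, ExtProjVanishes n M)
    (hI : ∀ J : C, Injective J → HasFiniteProjectiveDimension J) (M : C) :
    HasSpecialPrecover 0 M := by
  have of_le : ∀ k ≤ n, ∀ M : C, HasSpecialPrecover k M := fun k hk ↦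
    Nat.decreasingInduction (fun k _ ih M ↦ by
      obtain ⟨I, N, i, p, w, hJ, hS⟩ := exists_shortExact_injective M
      exact of_succ hS (hI I hJ) (ih N)) (fun M ↦ of_extProjVanishes (hn M)) hk
  exact of_le 0 n.zero_le M

end HasSpecialPrecover

end SpecialPrecover

end FiniteProjectiveDimension

/-! ### Complexes spliced from short exact sequences -/

theorem exists_int_chain {α : Type*} {r : α → α → Prop} {s t : Set α} (hts : t ⊆ s)
    (hs : ∀ x ∈ s, ∃ y ∈ s, r y x) (ht : ∀ x ∈ t, ∃ y ∈ t, r x y) (m : ℤ) {x : α} (hx : x ∈ t) :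
    ∃ W : ℤ → α, W m = x ∧ (∀ n, W n ∈ s) ∧ ∀ n, r (W (n + 1)) (W n) := by
  choose! f hfs hf using hs
  choose! g hgt hg using ht
  have hfx (k : ℕ) : f^[k] x ∈ s := (Set.MapsTo.iterate hfs k) (hts hx)
  have hgx (k : ℕ) : g^[k] x ∈ t := (Set.MapsTo.iterate hgt k) hx
  let W : ℤ → α
    | .ofNat k => f^[k] x
    | .negSucc k => g^[k + 1] x
  have hW : ∀ n, W n ∈ s
    | .ofNat k => hfx k
    | .negSucc k => hts (hgx (k + 1))
  have hr : ∀ n, r (W (n + 1)) (W n)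
    | .ofNat k => by
      have h := hf _ (hfx k)
      rwa [← Function.iterate_succ_apply' f] at h
    | .negSucc 0 => hg x hx
    | .negSucc (k + 1) => by
      have h := hg _ (hgx (k + 1))
      rwa [← Function.iterate_succ_apply' g] at h
  exact ⟨fun n ↦ W (n - m), congrArg W (sub_self m), fun n ↦ hW _,
    fun n ↦ by simpa only [add_sub_right_comm] using hr (n - m)⟩

section GorensteinProjective

open Abelian

variable {A : Type u} [Ring A]

theorem exactAt_linearYonedaObj_iff (K : ChainComplex (ModuleCat.{u} A) ℤ) (Q : ModuleCat.{u} A)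
    (n : ℤ) : (K.linearYonedaObj ℤ Q).ExactAt (n + 1) ↔
      ∀ f : K.X (n + 1) ⟶ Q, K.d (n + 1 + 1) (n + 1) ≫ f = 0 →
        ∃ g : K.X n ⟶ Q, K.d (n + 1) n ≫ g = f := by
  rw [HomologicalComplex.exactAt_iff' _ n (n + 1) (n + 1 + 1)
    (ComplexShape.prev_eq' _ (by simp)) (ComplexShape.next_eq' _ (by simp)),
    ShortComplex.moduleCat_exact_iff]
  rfl

section Splice

variable {ι : Type*} [AddRightCancelSemigroup ι] [One ι] [DecidableEq ι]
  {W P : ι → ModuleCat.{u} A} {i : ∀ n, W (n + 1) ⟶ P n} {p : ∀ n, P n ⟶ W n}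

/-- The complex obtained by splicing the short exact sequences `W (n + 1) ⟶ P n ⟶ W n`. The index
set `ι` is `ℤ` for complete resolutions and `ℕ` for resolutions. -/
noncomputable def splice (w : ∀ n, i n ≫ p n = 0) : ChainComplex (ModuleCat.{u} A) ι :=
  ChainComplex.of P (fun n ↦ p (n + 1) ≫ i n) fun n ↦ by
    rw [Category.assoc, reassoc_of% (w (n + 1)), Limits.zero_comp, Limits.comp_zero]

variable {w : ∀ n, i n ≫ p n = 0}

theorem splice_d (n : ι) : (splice w).d (n + 1) n = p (n + 1) ≫ i n :=
  ChainComplex.of_d P (fun n ↦ p (n + 1) ≫ i n) n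

theorem splice_d_comp (n : ι) : (splice w).d (n + 1) n ≫ p n = 0 := by
  rw [splice_d]
  exact (Category.assoc _ _ _).trans ((congrArg _ (w n)).trans Limits.comp_zero)

section

variable (hS : ∀ n, (ShortComplex.mk (i n) (p n) (w n)).ShortExact)

include hS

theorem exists_splice_d_eq (n : ι) (x : P n) (hx : p n x = 0) :
    ∃ y, (splice w).d (n + 1) n y = x := by
  obtain ⟨y, rfl⟩ := (ShortComplex.moduleCat_exact_iff _).1 (hS n).exact x hx
  obtain ⟨z, rfl⟩ := (hS (n + 1)).moduleCat_surjective_g y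
  exact ⟨z, ConcreteCategory.congr_hom (splice_d (w := w) n) z⟩

theorem exists_lift_splice_d (n : ι) {X : ModuleCat.{u} A}
    (hX : ∀ g : X ⟶ W (n + 1), ∃ g', g' ≫ p (n + 1) = g) (f : X ⟶ P n) (hf : f ≫ p n = 0) :
    ∃ g, g ≫ (splice w).d (n + 1) n = f := by
  have := (hS n).mono_f
  obtain ⟨g, rfl⟩ := (hS n).exact.lift' f hf
  obtain ⟨g', rfl⟩ := hX g
  refine ⟨g', ?_⟩
  rw [splice_d]
  exact (Category.assoc _ _ _).symm

theorem p_eq_zero_of_splice_d_eq_zero (n : ι) (x : P (n + 1))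
    (hx : (splice w).d (n + 1) n x = 0) : p (n + 1) x = 0 := by
  have hx : i n (p (n + 1) x) = 0 := by
    rw [← ModuleCat.comp_apply, ← splice_d (w := w)]
    exact hx
  exact (hS n).moduleCat_injective_f (hx.trans (map_zero _).symm)

theorem comp_p_eq_zero_of_comp_splice_d_eq_zero (n : ι) {X : ModuleCat.{u} A}
    (f : X ⟶ P (n + 1)) (hf : f ≫ (splice w).d (n + 1) n = 0) : f ≫ p (n + 1) = 0 := by
  have := (hS n).mono_f
  rw [splice_d] at hf
  exact (cancel_mono (i n)).1 (((Category.assoc _ _ _).trans hf).trans Limits.zero_comp.symm)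

theorem exists_splice_d_comp_eq (n : ι) {N : ModuleCat.{u} A}
    (hN : ∀ g : W (n + 1) ⟶ N, ∃ k, i n ≫ k = g) (f : P (n + 1) ⟶ N)
    (hf : (splice w).d (n + 1 + 1) (n + 1) ≫ f = 0) :
    ∃ k : P n ⟶ N, (splice w).d (n + 1) n ≫ k = f := by
  have := (hS (n + 1 + 1)).epi_g
  have := (hS (n + 1)).epi_g
  have hif : i (n + 1) ≫ f = 0 := by
    rw [splice_d] at hf
    exact (cancel_epi (p (n + 1 + 1))).1 <|
      ((Category.assoc _ _ _).symm.trans hf).trans Limits.comp_zero.symm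
  obtain ⟨g, rfl⟩ := (hS (n + 1)).exact.desc' f hif
  obtain ⟨k, rfl⟩ := hN g
  refine ⟨k, ?_⟩
  rw [splice_d]
  exact Category.assoc _ _ _

end

section Int

variable {W P : ℤ → ModuleCat.{u} A} {i : ∀ n, W (n + 1) ⟶ P n} {p : ∀ n, P n ⟶ W n}
  {w : ∀ n, i n ≫ p n = 0} (hS : ∀ n, (ShortComplex.mk (i n) (p n) (w n)).ShortExact)

include hS

theorem acyclic_splice : (splice w).Acyclic := fun n ↦ by
  obtain ⟨n, rfl⟩ : ∃ m, n = m + 1 := ⟨n - 1, by simp⟩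
  rw [HomologicalComplex.exactAt_iff' _ (n + 1 + 1) (n + 1) n (by simp) (by simp),
    ShortComplex.moduleCat_exact_iff]
  exact fun x hx ↦ exists_splice_d_eq hS (n + 1) x (p_eq_zero_of_splice_d_eq_zero hS n x hx)

theorem acyclic_linearYonedaObj_splice {Q : ModuleCat.{u} A}
    (hQ : ∀ n, Subsingleton (Ext (W n) Q 1)) : ((splice w).linearYonedaObj ℤ Q).Acyclic :=
  fun n ↦ by
    obtain ⟨n, rfl⟩ : ∃ m, n = m + 1 := ⟨n - 1, by simp⟩
    exact (exactAt_linearYonedaObj_iff _ _ _).2 <| exists_splice_d_comp_eq hS n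
      (exists_extension_of_subsingleton_ext_one (hS n) (hQ n))

theorem nonempty_cycles_splice_iso (n : ℤ) :
    Nonempty ((splice w).cycles n ≅ W (n + 1)) := by
  obtain ⟨n, rfl⟩ : ∃ m, n = m + 1 := ⟨n - 1, by simp⟩
  have := (hS n).mono_f
  have h₁ := (splice w).cyclesIsKernel (n + 1) n (ComplexShape.next_eq' (.down ℤ) rfl)
  have h₂ := Limits.isKernelCompMono (h := (splice w).d (n + 1) n) (hS (n + 1)).fIsKernel (i n)
    (splice_d n)
  exact ⟨h₁.conePointUniqueUpToIso h₂⟩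

theorem isGorensteinProjective_of_splice (hP : ∀ n, Projective (P n))
    (hW : ∀ n (Q : ModuleCat.{u} A), Projective Q → Subsingleton (Ext (W n) Q 1)) :
    IsGorensteinProjective (W 1) :=
  ⟨splice w, ⟨hP, acyclic_splice hS, fun Q hQ ↦ acyclic_linearYonedaObj_splice hS (hW · Q hQ)⟩,
    by simpa only [zero_add] using nonempty_cycles_splice_iso hS 0⟩

end Int

end Splice

theorem shortExact_cycles_of_acyclic {C : Type*} [Category* C] [Abelian C] {ι : Type*}
    [AddRightCancelSemigroup ι] [One ι] {K : ChainComplex C ι} (hK : K.Acyclic) (n : ι) :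
    (ShortComplex.mk (K.iCycles (n + 1)) (K.toCycles (n + 1) n)
      (by rw [← cancel_mono (K.iCycles n)]; simp)).ShortExact where
  exact := ShortComplex.exact_of_f_is_kernel _ (Limits.isKernelOfComp (K.iCycles n)
    (K.d (n + 1) n) (K.cyclesIsKernel (n + 1) n (ComplexShape.next_eq' _ rfl)) _ (by simp))
  mono_f := inferInstanceAs (Mono (K.iCycles (n + 1)))
  epi_g := Preadditive.epi_of_isZero_cokernel' _
    (K.homologyIsCokernel (n + 1) n (ComplexShape.prev_eq' _ rfl))
    ((K.exactAt_iff_isZero_homology n).1 (hK n))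

/-- The left half of a totally acyclic complex is any projective resolution of `K`; the right half
is obtained by iterating `h`. -/
theorem isGorensteinProjective_of_coinduction {P : ModuleCat.{u} A → Prop}
    (hExt : ∀ K, P K → ExtProjVanishes 0 K) (h : ∀ K, P K → ∃ K', P K' ∧ IsSyzygy K K')
    {K : ModuleCat.{u} A} (hK : P K) : IsGorensteinProjective K := by
  have left (K : ModuleCat.{u} A) (hK : ExtProjVanishes 0 K) :
      ∃ K', ExtProjVanishes 0 K' ∧ IsSyzygy K' K := by
    obtain ⟨K', P, i, p, w, hP, hS⟩ := exists_isSyzygy K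
    exact ⟨K', .kernel hS (.of_projective hP 0) hK zero_le_one, P, i, p, w, hP, hS⟩
  obtain ⟨W, rfl, hW, hsyz⟩ := exists_int_chain (s := {K | ExtProjVanishes 0 K})
    (t := {K | P K}) hExt left h 1 hK
  choose P i p w hP hS using hsyz
  exact isGorensteinProjective_of_splice hS hP fun n Q hQ ↦ hW n Q hQ 1 zero_lt_one

namespace IsTotallyAcyclic

variable {P : ChainComplex (ModuleCat.{u} A) ℤ} (hP : IsTotallyAcyclic P)

include hP

theorem isSyzygy_cycles (n : ℤ) : IsSyzygy (P.cycles (n + 1)) (P.cycles n) :=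
  ⟨_, _, _, _, hP.projective (n + 1), shortExact_cycles_of_acyclic hP.acyclic n⟩

theorem subsingleton_ext_one_cycles (n : ℤ) {Q : ModuleCat.{u} A} (hQ : Projective Q) :
    Subsingleton (Ext (P.cycles n) Q 1) := by
  have := hP.projective (n + 1)
  refine subsingleton_ext_one_of_exists_extension (shortExact_cycles_of_acyclic hP.acyclic n)
    (Ext.subsingleton_of_projective _ _ _) fun (f : P.cycles (n + 1) ⟶ Q) ↦ ?_
  obtain ⟨g, hg⟩ := (exactAt_linearYonedaObj_iff P Q (n + 1)).1 (hP.acyclic_hom Q hQ _)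
    (P.toCycles _ (n + 1) ≫ f) (by simp)
  have := (shortExact_cycles_of_acyclic hP.acyclic (n + 1)).epi_g
  exact ⟨g, (cancel_epi (P.toCycles (n + 1 + 1) (n + 1))).1 (by simpa using hg)⟩

theorem extProjVanishes_cycles (n : ℤ) : ExtProjVanishes 0 (P.cycles n) := by
  intro Q hQ i hi
  obtain ⟨i, rfl⟩ := Nat.exists_eq_succ_of_ne_zero hi.ne'
  induction i generalizing n with
  | zero => exact hP.subsingleton_ext_one_cycles n hQ
  | succ i ih =>
    have := hP.projective (n + 1)
    exact subsingleton_ext_X₃ (shortExact_cycles_of_acyclic hP.acyclic n) (i + 1) Q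
      (ih (n + 1) (by simp)) (Ext.subsingleton_of_projective _ _ _)

theorem isGorensteinProjective_cycles (n : ℤ) : IsGorensteinProjective (P.cycles n) := by
  refine isGorensteinProjective_of_coinduction (P := fun K ↦ ∃ m, K = P.cycles m) ?_ ?_ ⟨n, rfl⟩
  · rintro _ ⟨m, rfl⟩
    exact hP.extProjVanishes_cycles m
  · rintro _ ⟨m, rfl⟩
    refine ⟨_, ⟨m - 1, rfl⟩, ?_⟩
    simpa only [sub_add_cancel] using hP.isSyzygy_cycles (m - 1)

end IsTotallyAcyclic

namespace IsGorensteinProjective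

variable {M N : ModuleCat.{u} A}

theorem of_iso (e : M ≅ N) (hM : IsGorensteinProjective M) : IsGorensteinProjective N := by
  obtain ⟨P, hP, ⟨e'⟩⟩ := hM
  exact ⟨P, hP, ⟨e' ≪≫ e⟩⟩

theorem extProjVanishes (hM : IsGorensteinProjective M) : ExtProjVanishes 0 M := by
  obtain ⟨P, hP, ⟨e⟩⟩ := hM
  exact (hP.extProjVanishes_cycles 0).of_retract (Retract.ofIso e.symm)

theorem exists_isSyzygy (hM : IsGorensteinProjective M) :
    ∃ M', IsGorensteinProjective M' ∧ IsSyzygy M M' := by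
  obtain ⟨P, hP, ⟨e⟩⟩ := hM
  exact ⟨P.cycles (-1), hP.isGorensteinProjective_cycles (-1),
    IsSyzygy.of_iso (hP.isSyzygy_cycles (-1)) e⟩

end IsGorensteinProjective

end GorensteinProjective

/-! ### Closure properties of Gorenstein-projective modules -/

section Closure

open Abelian Limits

/-- The smallest class of objects containing a given class and closed under extensions. -/
inductive ExtensionClosure {C : Type*} [Category* C] [HasZeroMorphisms C] (P : C → Prop) : C → Prop
  | of {M : C} (hM : P M) : ExtensionClosure P M
  | extension {K E N : C} {i : K ⟶ E} {p : E ⟶ N} {w : i ≫ p = 0}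
      (hS : (ShortComplex.mk i p w).ShortExact) (hK : ExtensionClosure P K)
      (hN : ExtensionClosure P N) : ExtensionClosure P E

variable {A : Type u} [Ring A]

/-- Direct summands of Gorenstein-projective modules, used to show that they are themselves
Gorenstein-projective. The module `M'` is a complement of `M`. -/
def IsGPSummand (M : ModuleCat.{u} A) : Prop :=
  ∃ M' : ModuleCat.{u} A, IsGorensteinProjective (M ⊞ M')

theorem IsGorensteinProjective.isGPSummand {M : ModuleCat.{u} A} (hM : IsGorensteinProjective M) :
    IsGPSummand M :=
  ⟨ModuleCat.of A PUnit, hM.of_iso (isoBiprodZero (ModuleCat.isZero_of_subsingleton _))⟩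

theorem extProjVanishes_zero_of_extensionClosure {M : ModuleCat.{u} A}
    (hM : ExtensionClosure IsGPSummand M) : ExtProjVanishes 0 M := by
  induction hM with
  | of h =>
    obtain ⟨M', hM⟩ := h
    exact hM.extProjVanishes.of_retract ⟨biprod.inl, biprod.fst, by simp⟩
  | extension hS _ _ hK hN => exact .extension hS hK hN

/-- If `M ⊞ M'` embeds in a projective `Q`, then `Q / M` is an extension of `Q / (M ⊞ M')` by the
complement `M'`; this is why the class has to be closed under extensions as well. -/
theorem exists_isSyzygy_of_extensionClosure {M : ModuleCat.{u} A}
    (hM : ExtensionClosure IsGPSummand M) :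
    ∃ N : ModuleCat.{u} A, ExtensionClosure IsGPSummand N ∧ IsSyzygy M N := by
  induction hM with
  | @of M h =>
    obtain ⟨M', hM⟩ := h
    obtain ⟨D, hD, hsyz⟩ := hM.exists_isSyzygy
    obtain ⟨Y, n, r, h', hMY, hY⟩ :=
      exists_isSyzygy_left (ShortComplex.Splitting.ofHasBinaryBiproduct M M').shortExact hsyz
    have hM' : IsGPSummand M' := ⟨M, hM.of_iso (biprod.braiding M M')⟩
    exact ⟨Y, .extension hY (.of hM') (.of hD.isGPSummand), hMY⟩
  | extension hS _ hN ihK ihN =>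
    obtain ⟨D₁, hD₁, h₁⟩ := ihK
    obtain ⟨D₂, hD₂, h₂⟩ := ihN
    obtain ⟨D, f, g, h, hED, hD⟩ := exists_isSyzygy_extension hS h₁ h₂ fun Q hQ ↦
      extProjVanishes_zero_of_extensionClosure hN Q hQ 1 zero_lt_one
    exact ⟨D, .extension hD hD₁ hD₂, hED⟩

theorem isGorensteinProjective_of_extensionClosure {M : ModuleCat.{u} A}
    (hM : ExtensionClosure IsGPSummand M) : IsGorensteinProjective M :=
  isGorensteinProjective_of_coinduction (fun _ ↦ extProjVanishes_zero_of_extensionClosure)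
    (fun _ ↦ exists_isSyzygy_of_extensionClosure) hM

theorem IsGPSummand.isGorensteinProjective {M : ModuleCat.{u} A} (hM : IsGPSummand M) :
    IsGorensteinProjective M := isGorensteinProjective_of_extensionClosure (.of hM)

theorem IsGorensteinProjective.extension {K E N : ModuleCat.{u} A} {i : K ⟶ E} {p : E ⟶ N}
    {w : i ≫ p = 0} (hS : (ShortComplex.mk i p w).ShortExact) (hK : IsGorensteinProjective K)
    (hN : IsGorensteinProjective N) : IsGorensteinProjective E :=
  isGorensteinProjective_of_extensionClosure
    (.extension hS (.of hK.isGPSummand) (.of hN.isGPSummand))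

theorem ExtProjVanishes.isGorensteinProjective {n : ℕ}
    (hn : ∀ M : ModuleCat.{u} A, ExtProjVanishes n M)
    (hI : ∀ J : ModuleCat.{u} A, Injective J → HasFiniteProjectiveDimension J)
    {M : ModuleCat.{u} A} (hM : ExtProjVanishes 0 M) : IsGorensteinProjective M := by
  refine isGorensteinProjective_of_coinduction (fun _ h ↦ h) (fun K hK ↦ ?_) hM
  obtain ⟨I, N, i, p, w, hJ, hS⟩ := exists_shortExact_injective K
  obtain ⟨Y, G, i', p', w', hS', hY, hG⟩ := HasSpecialPrecover.zero_of_forall hn hI N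
  obtain ⟨W, a, b, q, r, h, h', hWG, hWI⟩ := exists_pullback hS hS'
  have hW : HasFiniteProjectiveDimension W := .extension hWI hY (hI I hJ)
  exact ⟨G, hG, W, a, q, h, hW.projective (.extension hWG hK hG), hWG⟩

end Closure

/-! ### Proper resolutions and their length -/

section Resolution

open Abelian

variable {A : Type u} [Ring A]

section Splice

variable {W G : ℕ → ModuleCat.{u} A} {i : ∀ n, W (n + 1) ⟶ G n} {p : ∀ n, G n ⟶ W n}
  {w : ∀ n, i n ≫ p n = 0} (hS : ∀ n, (ShortComplex.mk (i n) (p n) (w n)).ShortExact)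

include hS

theorem acyclic_augment_splice : ((splice w).augment (p 0) (splice_d_comp 0)).Acyclic
  | 0 => by
    rw [HomologicalComplex.exactAt_iff' _ 1 0 0 (by simp) (by simp),
      ShortComplex.moduleCat_exact_iff]
    exact fun x _ ↦ (hS 0).moduleCat_surjective_g x
  | 1 => by
    rw [HomologicalComplex.exactAt_iff' _ 2 1 0 (by simp) (by simp),
      ShortComplex.moduleCat_exact_iff]
    exact exists_splice_d_eq hS 0
  | n + 2 => by
    rw [HomologicalComplex.exactAt_iff' _ (n + 3) (n + 2) (n + 1) (by simp) (by simp),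
      ShortComplex.moduleCat_exact_iff]
    exact fun x hx ↦ exists_splice_d_eq hS (n + 1) x (p_eq_zero_of_splice_d_eq_zero hS n x hx)

variable (hp : ∀ n (X : ModuleCat.{u} A), IsGorensteinProjective X →
  ∀ f : X ⟶ W n, ∃ g, g ≫ p n = f)

include hp

theorem isRightGPAcyclic_augment_splice :
    IsRightGPAcyclic ((splice w).augment (p 0) (splice_d_comp 0)) := by
  intro X hX n
  match n with
  | 0 =>
    rw [HomologicalComplex.exactAt_iff' _ 1 0 0 (by simp) (by simp), ShortComplex.ab_exact_iff]
    exact fun f _ ↦ hp 0 X hX f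
  | 1 =>
    rw [HomologicalComplex.exactAt_iff' _ 2 1 0 (by simp) (by simp), ShortComplex.ab_exact_iff]
    exact exists_lift_splice_d hS 0 (hp 1 X hX)
  | n + 2 =>
    rw [HomologicalComplex.exactAt_iff' _ (n + 3) (n + 2) (n + 1) (by simp) (by simp),
      ShortComplex.ab_exact_iff]
    exact fun f hf ↦ exists_lift_splice_d hS (n + 1) (hp (n + 2) X hX) f
      (comp_p_eq_zero_of_comp_splice_d_eq_zero hS n f hf)

end Splice

namespace ProperGPResolution

variable {M : ModuleCat.{u} A} (R : ProperGPResolution M)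

theorem isZero_ext_succ_iff (N : ModuleCat.{u} A) (n : ℕ) : Limits.IsZero (R.ext (n + 1) N) ↔
    ∀ f : R.complex.X (n + 1) ⟶ N, R.complex.d (n + 1 + 1) (n + 1) ≫ f = 0 →
      ∃ g : R.complex.X n ⟶ N, R.complex.d (n + 1) n ≫ g = f := by
  rw [ext, ← HomologicalComplex.exactAt_iff_isZero_homology,
    HomologicalComplex.exactAt_iff' _ n (n + 1) (n + 2) (by simp) (by simp),
    ShortComplex.moduleCat_exact_iff]
  rfl

/-- The proper GP-resolution spliced from short exact sequences `W (n + 1) ⟶ G n ⟶ W n` whose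
epimorphisms are Gorenstein-projective precovers. -/
noncomputable def ofShortExact {W G : ℕ → ModuleCat.{u} A} {i : ∀ n, W (n + 1) ⟶ G n}
    {p : ∀ n, G n ⟶ W n} {w : ∀ n, i n ≫ p n = 0}
    (hS : ∀ n, (ShortComplex.mk (i n) (p n) (w n)).ShortExact)
    (hG : ∀ n, IsGorensteinProjective (G n))
    (hp : ∀ n (X : ModuleCat.{u} A), IsGorensteinProjective X →
      ∀ f : X ⟶ W n, ∃ g, g ≫ p n = f) : ProperGPResolution (W 0) where
  complex := splice w
  ε := p 0
  d_comp_ε := splice_d_comp 0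
  gorensteinProjective := hG
  acyclic := acyclic_augment_splice hS
  proper := isRightGPAcyclic_augment_splice hS hp

theorem isZero_ext_ofShortExact {W G : ℕ → ModuleCat.{u} A} {i : ∀ n, W (n + 1) ⟶ G n}
    {p : ∀ n, G n ⟶ W n} {w : ∀ n, i n ≫ p n = 0}
    (hS : ∀ n, (ShortComplex.mk (i n) (p n) (w n)).ShortExact)
    (hG : ∀ n, IsGorensteinProjective (G n))
    (hp : ∀ n (X : ModuleCat.{u} A), IsGorensteinProjective X → ∀ f : X ⟶ W n, ∃ g, g ≫ p n = f)
    (n : ℕ) {ρ : G n ⟶ W (n + 1)} (hρ : i n ≫ ρ = 𝟙 _) (N : ModuleCat.{u} A) :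
    Limits.IsZero ((ofShortExact hS hG hp).ext (n + 1) N) :=
  (isZero_ext_succ_iff _ N n).2 <| exists_splice_d_comp_eq hS n fun g ↦
    ⟨ρ ≫ g, by rw [reassoc_of% hρ]⟩

/-- The exact complex `⋯ ⟶ G₁ ⟶ G₀ ⟶ M` underlying a proper GP-resolution of `M`; it has `M` in
degree `0` and `G_n` in degree `n + 1`. -/
noncomputable abbrev augmented : ChainComplex (ModuleCat.{u} A) ℕ :=
  R.complex.augment R.ε R.d_comp_ε

theorem nonempty_cycles_augmented_iso : Nonempty (R.augmented.cycles 0 ≅ M) :=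
  have : IsIso (R.augmented.iCycles 0) :=
    R.augmented.isIso_iCycles 0 _ rfl (R.augmented.shape _ _ (by simp))
  ⟨(asIso (R.augmented.iCycles 0) : _ ≅ R.augmented.X 0)⟩

theorem exists_retraction_of_isZero_ext (n : ℕ) (h : ∀ N, Limits.IsZero (R.ext (n + 1) N)) :
    ∃ ρ : R.complex.X n ⟶ R.augmented.cycles (n + 1), R.augmented.iCycles (n + 1) ≫ ρ = 𝟙 _ := by
  let C := R.augmented
  have := (shortExact_cycles_of_acyclic R.acyclic (n + 1)).epi_g
  have hd : C.d (n + 1 + 1 + 1) (n + 1 + 1) ≫ C.toCycles (n + 1 + 1) (n + 1) = 0 := by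
    rw [← cancel_mono (C.iCycles (n + 1))]
    simp
  obtain ⟨ρ, hρ⟩ := (R.isZero_ext_succ_iff (C.cycles (n + 1)) n).1 (h _) _ hd
  refine ⟨ρ, (cancel_epi (C.toCycles (n + 1 + 1) (n + 1))).1 ?_⟩
  exact (C.toCycles_i_assoc (n + 1 + 1) (n + 1) ρ).trans (hρ.trans (Category.comp_id _).symm)

theorem gpDim_le_iff (n : ℕ) : gpDim M ≤ n ↔ ∀ k, n < k → ∀ N, Limits.IsZero (R.ext k N) := by
  rw [gpDim_eq R, iSup₂_le_iff]
  refine forall_congr' fun k ↦ ⟨fun h hk N ↦ by_contra fun hN ↦ ?_, fun h ⟨N, hN⟩ ↦ ?_⟩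
  · exact hk.not_ge (by exact_mod_cast h ⟨N, hN⟩)
  · exact_mod_cast not_lt.1 fun hk ↦ hN (h hk N)

end ProperGPResolution

theorem lt_top_iff_exists_le_natCast {x : WithBot ℕ∞} : x < ⊤ ↔ ∃ n : ℕ, x ≤ n := by
  refine ⟨fun h ↦ ?_, fun ⟨n, hn⟩ ↦ hn.trans_lt (WithBot.coe_lt_coe.2 (ENat.natCast_lt_top n))⟩
  induction x with
  | bot => exact ⟨0, bot_le⟩
  | coe x =>
    obtain ⟨n, rfl⟩ := ENat.ne_top_iff_exists.1 (WithBot.coe_lt_coe.1 h).ne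
    exact ⟨n, le_rfl⟩

theorem eq_of_forall_le_natCast_iff {x y : WithBot ℕ∞} (hbot : x = ⊥ ↔ y = ⊥)
    (h : ∀ n : ℕ, x ≤ n ↔ y ≤ n) : x = y := by
  refine eq_of_forall_ge_iff fun z ↦ ?_
  induction z with
  | bot => simpa using hbot
  | coe z =>
    induction z with
    | top => exact iff_of_true le_top le_top
    | coe n => exact h n

theorem nonempty_properGPResolution_of_gpDim_lt_top {M : ModuleCat.{u} A} (h : gpDim M < ⊤) :
    Nonempty (ProperGPResolution M) := by
  by_contra hM
  rw [not_nonempty_iff] at hM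
  rw [gpDim, iInf_of_empty] at h
  exact lt_irrefl _ h

theorem isZero_of_gpDim_eq_bot {M : ModuleCat.{u} A} (h : gpDim M = ⊥) : Limits.IsZero M := by
  obtain ⟨R⟩ := nonempty_properGPResolution_of_gpDim_lt_top (h.trans_lt bot_lt_top)
  have hε : R.ε = 0 := by
    have h₀ : Limits.IsZero (R.ext 0 M) := by
      rw [gpDim_eq R, iSup₂_eq_bot] at h
      by_contra hM
      exact WithBot.natCast_ne_bot 0 (h 0 ⟨M, hM⟩)
    rw [ProperGPResolution.ext, isZero_homology_linearYonedaObj_iff] at h₀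
    obtain ⟨g, hg⟩ := h₀ R.ε R.d_comp_ε
    rw [← hg, R.complex.shape 0 _ (by simp), Limits.zero_comp]
  have : Epi R.ε := by
    have := R.acyclic 0
    rw [HomologicalComplex.exactAt_iff' _ 1 0 0 (by simp) (by simp)] at this
    exact this.epi_f rfl
  exact Limits.IsZero.of_epi_eq_zero R.ε hε

theorem gpDim_eq_bot_of_subsingleton [Subsingleton A] {M : ModuleCat.{u} A} (h : gpDim M < ⊤) :
    gpDim M = ⊥ := by
  obtain ⟨R⟩ := nonempty_properGPResolution_of_gpDim_lt_top h
  rw [gpDim_eq R, iSup₂_eq_bot]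
  intro n ⟨N, hN⟩
  have : Subsingleton N := Module.subsingleton A N
  refine absurd ?_ hN
  rw [ProperGPResolution.ext, isZero_homology_linearYonedaObj_iff]
  exact fun f _ ↦ ⟨0, (ModuleCat.isZero_of_subsingleton N).eq_of_tgt _ _⟩

/-- Iterate special precovers, and stop as soon as `Ext^1(-, Q)` of the syzygy vanishes: the next
short exact sequence then splits. -/
theorem exists_properGPResolution {n : ℕ} (hn : ∀ M : ModuleCat.{u} A, ExtProjVanishes n M)
    (hI : ∀ J : ModuleCat.{u} A, Injective J → HasFiniteProjectiveDimension J)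
    (M : ModuleCat.{u} A) :
    ∃ R : ProperGPResolution M, ∀ k, n < k → ∀ N, Limits.IsZero (R.ext k N) := by
  choose Y G i p w hS hY hG using HasSpecialPrecover.zero_of_forall hn hI
  let W (k : ℕ) : ModuleCat.{u} A := Y^[k] M
  have hW (k : ℕ) : W (k + 1) = Y (W k) := Function.iterate_succ_apply' Y k M
  have hWY (k : ℕ) : HasFiniteProjectiveDimension (W (k + 1)) := hW k ▸ hY _
  have hWS (k : ℕ) : ∃ (i : W (k + 1) ⟶ G (W k)) (p : G (W k) ⟶ W k) (w : i ≫ p = 0),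
      (ShortComplex.mk i p w).ShortExact := by
    rw [hW]
    exact ⟨i _, p _, w _, hS _⟩
  choose i p w hS using hWS
  have hE (k : ℕ) : ExtProjVanishes (n - k) (W k) := by
    induction k with
    | zero => exact hn M
    | succ k ih => exact .kernel (hS k) (fun Q hQ j hj ↦ hG (W k) Q hQ j (by lia)) ih (by lia)
  let R : ProperGPResolution M := .ofShortExact hS
    (fun k ↦ (hG (W k)).isGorensteinProjective hn hI) fun k X hX ↦
      exists_lift_of_subsingleton_ext_one (hS k)
        ((hWY k).subsingleton_ext hX.extProjVanishes 1 zero_lt_one)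
  refine ⟨R, fun k hk N ↦ ?_⟩
  obtain ⟨k, rfl⟩ := Nat.exists_eq_succ_of_ne_zero (Nat.ne_zero_of_lt hk)
  obtain ⟨ρ, hρ⟩ := exists_extension_of_subsingleton_ext_one (hS k)
    ((hWY k).subsingleton_ext (hE k) 1 (by lia)) (𝟙 _)
  exact ProperGPResolution.isZero_ext_ofShortExact hS _ _ k hρ N

theorem globalGPDim_le {n : ℕ} (hn : ∀ M : ModuleCat.{u} A, ExtProjVanishes n M)
    (hI : ∀ J : ModuleCat.{u} A, Injective J → HasFiniteProjectiveDimension J) :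
    globalGPDim A ≤ n :=
  iSup_le fun M ↦ by
    obtain ⟨R, hR⟩ := exists_properGPResolution hn hI M
    exact (R.gpDim_le_iff n).2 hR

theorem IsGorensteinProjective.of_shortExact_retraction {K G M : ModuleCat.{u} A} {i : K ⟶ G}
    {p : G ⟶ M} {w : i ≫ p = 0} (hS : (ShortComplex.mk i p w).ShortExact)
    (hG : IsGorensteinProjective G) {ρ : G ⟶ K} (hρ : i ≫ ρ = 𝟙 _) :
    IsGorensteinProjective M :=
  let s := ShortComplex.Splitting.ofExactOfRetraction _ hS.exact ρ hρ hS.epi_g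
  IsGPSummand.isGorensteinProjective
    ⟨K, hG.of_iso (s.isoBinaryBiproduct ≪≫ Limits.biprod.braiding K M)⟩

theorem gpDim_induction {P : ℕ → ModuleCat.{u} A → Prop}
    (iso : ∀ {n M N}, (M ≅ N) → P n M → P n N) (zero : ∀ {M}, IsGorensteinProjective M → P 0 M)
    (succ : ∀ {n K G M} {i : K ⟶ G} {p : G ⟶ M} {w : i ≫ p = 0},
      (ShortComplex.mk i p w).ShortExact → IsGorensteinProjective G → P n K → P (n + 1) M)
    {n : ℕ} {M : ModuleCat.{u} A} (hM : gpDim M ≤ n) : P n M := by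
  obtain ⟨R⟩ := nonempty_properGPResolution_of_gpDim_lt_top
    (lt_top_iff_exists_le_natCast.2 ⟨n, hM⟩)
  have hR := (R.gpDim_le_iff n).1 hM
  have hS := shortExact_cycles_of_acyclic R.acyclic
  have of_add : ∀ k j, j + k = n → P k (R.augmented.cycles j) := by
    intro k
    induction k with
    | zero =>
      rintro j rfl
      obtain ⟨ρ, hρ⟩ := R.exists_retraction_of_isZero_ext j (hR (j + 1) (by lia))
      exact zero (.of_shortExact_retraction (hS j) (R.gorensteinProjective j) hρ)
    | succ k ih =>
      exact fun j hj ↦ succ (hS j) (R.gorensteinProjective j) (ih (j + 1) (by lia))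
  obtain ⟨e⟩ := R.nonempty_cycles_augmented_iso
  exact iso e (of_add n 0 (zero_add n))

theorem ExtProjVanishes.of_gpDim_le {n : ℕ} {M : ModuleCat.{u} A} (hM : gpDim M ≤ n) :
    ExtProjVanishes n M := by
  refine gpDim_induction (fun e h ↦ h.of_retract (Retract.ofIso e.symm))
    (fun h ↦ h.extProjVanishes) (fun {n K G M i p w} hS hG hK Q hQ k hk ↦ ?_) hM
  obtain ⟨k, rfl⟩ := Nat.exists_eq_succ_of_ne_zero (Nat.ne_zero_of_lt hk)
  exact subsingleton_ext_X₃ hS k Q (hK Q hQ k (by lia)) (hG.extProjVanishes Q hQ _ (by lia))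

/-- `M` embeds into a module of finite projective dimension with Gorenstein-projective cokernel.
Such an embedding is a special preenvelope, dual to a special precover. -/
def HasSpecialPreenvelope (M : ModuleCat.{u} A) : Prop :=
  ∃ (Y C : ModuleCat.{u} A) (i : M ⟶ Y) (p : Y ⟶ C) (w : i ≫ p = 0),
    (ShortComplex.mk i p w).ShortExact ∧ HasFiniteProjectiveDimension Y ∧ IsGorensteinProjective C

namespace HasSpecialPreenvelope

theorem of_iso {M N : ModuleCat.{u} A} (e : M ≅ N) (hM : HasSpecialPreenvelope M) :
    HasSpecialPreenvelope N := by
  obtain ⟨Y, C, i, p, w, hS, hY, hC⟩ := hM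
  exact ⟨Y, C, e.inv ≫ i, p, _, shortExact_iso_comp e hS, hY, hC⟩

theorem of_isGorensteinProjective {M : ModuleCat.{u} A} (hM : IsGorensteinProjective M) :
    HasSpecialPreenvelope M := by
  obtain ⟨C, hC, Q, i, p, w, hQ, hS⟩ := hM.exists_isSyzygy
  exact ⟨Q, C, i, p, w, hS, .of_projective hQ, hC⟩

/-- The pushout of `G` along a preenvelope of `K` is Gorenstein-projective, so it embeds into a
projective module. -/
theorem cokernel {K G M : ModuleCat.{u} A} {i : K ⟶ G} {p : G ⟶ M} {w : i ≫ p = 0}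
    (hS : (ShortComplex.mk i p w).ShortExact) (hG : IsGorensteinProjective G)
    (hK : HasSpecialPreenvelope K) : HasSpecialPreenvelope M := by
  obtain ⟨Y, C, i', p', w', hS', hY, hC⟩ := hK
  obtain ⟨W, a, b, q, r, h, h', hYW, hGW⟩ := exists_pushout hS hS'
  obtain ⟨C', hC', Q, j, t, v, hQ, hT⟩ := (hG.extension hGW hC).exists_isSyzygy
  obtain ⟨Y', π, m, s, h, h', hYQ, hM⟩ := exists_shortExact_comp_mono hYW hT
  exact ⟨Y', C', m, s, h', hM, .cokernel hYQ hY (.of_projective hQ), hC'⟩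

theorem of_gpDim_le {n : ℕ} {M : ModuleCat.{u} A} (hM : gpDim M ≤ n) : HasSpecialPreenvelope M :=
  gpDim_induction (P := fun _ ↦ HasSpecialPreenvelope) of_iso of_isGorensteinProjective cokernel hM

end HasSpecialPreenvelope

section GlobalDimension

variable {n : ℕ}

theorem ExtProjVanishes.of_globalGPDim_le (hA : globalGPDim A ≤ n) (M : ModuleCat.{u} A) :
    ExtProjVanishes n M := .of_gpDim_le ((le_iSup gpDim M).trans hA)

theorem hasInjectiveDimensionLT_of_globalGPDim_le (hA : globalGPDim A ≤ n) {Q : ModuleCat.{u} A}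
    (hQ : Projective Q) : HasInjectiveDimensionLT Q (n + 1) :=
  hasInjectiveDimensionLT_of_enoughProjectives Q (n + 1) fun M ↦
    ExtProjVanishes.of_globalGPDim_le hA M Q hQ _ n.lt_succ_self

theorem hasProjectiveDimensionLT_of_globalGPDim_le (hA : globalGPDim A ≤ n) {J : ModuleCat.{u} A}
    (hJ : Injective J) : HasProjectiveDimensionLT J (n + 1) := by
  obtain ⟨Y, C, i, p, w, hS, hY, -⟩ :=
    HasSpecialPreenvelope.of_gpDim_le ((le_iSup gpDim J).trans hA)
  have := hS.mono_f
  exact (hY.of_retract ⟨i, Injective.factorThru (𝟙 J) i, Injective.comp_factorThru _ _⟩)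
    |>.hasProjectiveDimensionLT (.of_globalGPDim_le hA J)

theorem globalGPDim_eq_bot_iff (h : globalGPDim A < ⊤) : globalGPDim A = ⊥ ↔ Subsingleton A := by
  refine ⟨fun hA ↦ ?_, fun hA ↦ ?_⟩
  · rw [globalGPDim, iSup_eq_bot] at hA
    exact ModuleCat.isZero_iff_subsingleton.1 (isZero_of_gpDim_eq_bot (hA (ModuleCat.of A A)))
  · exact iSup_eq_bot.2 fun M ↦ gpDim_eq_bot_of_subsingleton ((le_iSup gpDim M).trans_lt h)

end GlobalDimension

end Resolution

/-! ### Gorenstein algebras -/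

section Gorenstein

variable {A : Type u} [Ring A] {m n : ℕ}

theorem injectiveDimension_op_eq :
    injectiveDimension (ModuleCat.of Aᵐᵒᵖ A) = injectiveDimension (ModuleCat.of Aᵐᵒᵖ Aᵐᵒᵖ) :=
  ModuleCat.injectiveDimension_eq_of_linearEquiv
    { MulOpposite.opAddEquiv with map_smul' := fun _ _ ↦ rfl }

theorem injectiveDimension_self_le_of_globalGPDim_le (h : globalGPDim A ≤ n) :
    injectiveDimension (ModuleCat.of A A) ≤ n :=
  (injectiveDimension_le_iff _ n).2 <| hasInjectiveDimensionLT_of_globalGPDim_le h <|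
    ModuleCat.projective_of_free (Module.Basis.singleton PUnit.{u + 1} A)

theorem injectiveDimension_op_le_of_globalGPDim_le [IsNoetherianRing Aᵐᵒᵖ]
    (h : globalGPDim A ≤ n) : injectiveDimension (ModuleCat.of Aᵐᵒᵖ A) ≤ n := by
  rw [injectiveDimension_op_eq]
  exact (injectiveDimension_le_iff _ n).2 <|
    hasInjectiveDimensionLT_self_of_injective (RingEquiv.opOp A) n fun _ ↦
      hasProjectiveDimensionLT_of_globalGPDim_le h

section Noetherian

variable [IsNoetherianRing A] [IsNoetherianRing Aᵐᵒᵖ]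

theorem globalGPDim_le_of_injectiveDimension_le
    (hA : injectiveDimension (ModuleCat.of A A) ≤ n)
    (hB : injectiveDimension (ModuleCat.of Aᵐᵒᵖ A) ≤ m) : globalGPDim A ≤ n := by
  rw [injectiveDimension_op_eq] at hB
  have hA := (injectiveDimension_le_iff _ n).1 hA
  have hB := (injectiveDimension_le_iff _ m).1 hB
  refine globalGPDim_le (fun M Q hQ i hi ↦ ?_) fun J hJ ↦ ?_
  · have := hasInjectiveDimensionLT_of_projective n hA Q
    exact HasInjectiveDimensionLT.subsingleton Q (n + 1) i hi M
  · exact ⟨m, hasProjectiveDimensionLT_of_hasInjectiveDimensionLT (RingEquiv.opOp A) n m hA hB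
      (hasInjectiveDimensionLT_of_ge J 1 _ (by lia))⟩

theorem injectiveDimension_self_le_of_op_le (hA : injectiveDimension (ModuleCat.of A A) ≤ m)
    (hB : injectiveDimension (ModuleCat.of Aᵐᵒᵖ A) ≤ n) :
    injectiveDimension (ModuleCat.of A A) ≤ n := by
  rw [injectiveDimension_op_eq] at hB
  have := (injectiveDimension_le_iff _ m).1 hA
  exact (injectiveDimension_le_iff _ n).2 <|
    hasInjectiveDimensionLT_of_hasInjectiveDimensionLT_add (RingEquiv.opOp A) n (m + 1)
      ((injectiveDimension_le_iff _ n).1 hB) (hasInjectiveDimensionLT_of_ge _ (m + 1) _ (by lia))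

theorem isGorensteinAlgebra_iff_globalGPDim_lt_top :
    IsGorensteinAlgebra A ↔ globalGPDim A < ⊤ := by
  simp only [IsGorensteinAlgebra, lt_top_iff_exists_le_natCast]
  refine ⟨fun ⟨⟨n, hn⟩, ⟨m, hm⟩⟩ ↦ ⟨n, globalGPDim_le_of_injectiveDimension_le hn hm⟩,
    fun ⟨n, hn⟩ ↦ ⟨⟨n, injectiveDimension_self_le_of_globalGPDim_le hn⟩,
      ⟨n, injectiveDimension_op_le_of_globalGPDim_le hn⟩⟩⟩

end Noetherian

end Gorenstein

theorem mainTheorem8_general (A : Type u) [Ring A] [IsNoetherianRing A] [IsNoetherianRing Aᵐᵒᵖ] :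
    (IsGorensteinAlgebra A ↔ globalGPDim A < ⊤) ∧
      (IsGorensteinAlgebra A →
        injectiveDimension (ModuleCat.of A A) = globalGPDim A ∧
          injectiveDimension (ModuleCat.of Aᵐᵒᵖ A) = globalGPDim A) := by
  refine ⟨isGorensteinAlgebra_iff_globalGPDim_lt_top, fun hG ↦ ?_⟩
  have hbot := globalGPDim_eq_bot_iff (isGorensteinAlgebra_iff_globalGPDim_lt_top.1 hG)
  obtain ⟨m, hm⟩ := lt_top_iff_exists_le_natCast.1 hG.1
  obtain ⟨m', hm'⟩ := lt_top_iff_exists_le_natCast.1 hG.2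
  constructor
  · refine eq_of_forall_le_natCast_iff ?_ fun n ↦
      ⟨fun hn ↦ globalGPDim_le_of_injectiveDimension_le hn hm',
        injectiveDimension_self_le_of_globalGPDim_le⟩
    rw [injectiveDimension_eq_bot_iff, ModuleCat.isZero_iff_subsingleton, hbot]
  · refine eq_of_forall_le_natCast_iff ?_ fun n ↦
      ⟨fun hn ↦ globalGPDim_le_of_injectiveDimension_le
        (injectiveDimension_self_le_of_op_le hm hn) hn,
        injectiveDimension_op_le_of_globalGPDim_le⟩
    rw [injectiveDimension_eq_bot_iff, ModuleCat.isZero_iff_subsingleton, hbot]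

theorem mainTheorem8 {R : Type*} [CommRing R] [IsArtinianRing R]
    (A : Type u) [Ring A] [Algebra R A] [Module.Finite R A] :
    (IsGorensteinAlgebra A ↔ globalGPDim A < ⊤) ∧
      (IsGorensteinAlgebra A →
        injectiveDimension (ModuleCat.of A A) = globalGPDim A ∧
          injectiveDimension (ModuleCat.of Aᵐᵒᵖ A) = globalGPDim A) := by
  have := IsNoetherianRing.of_finite R A
  have : Module.Finite R Aᵐᵒᵖ := Module.Finite.equiv (MulOpposite.opLinearEquiv R)
  have := IsNoetherianRing.of_finite R Aᵐᵒᵖ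
  exact mainTheorem8_general A
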